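/- Let $d\ge 1$ and $m\ge 1$. For $h:\mathbb R^d\to\mathbb R$ of class $C^{m-1}$ let $|h|_k=\max_{i_1,\dots,i_k}\sup_{w}\bigl|\frac{\partial^k h(w)}{\partial w_{i_1}\cdots\partial w_{i_k}}\bigr|$ for $0\le k\le m-1$ (so $|h|_0=\sup|h|$), and let $|h|_m$ be the largest Lipschitz constant, with respect to the Euclidean norm, of the partial derivatives of $h$ of order $m-1$. Let $\mathcal H_m$ be the set of all such $h$ with $|h|_k\le 1$ for $0\le k\le m$. For random vectors $X,Y$ in $\mathbb R^d$ (not necessarily defined on the same probability space) put $$d_m(X,Y)=\sup_{h\in\mathcal H_m}\bigl|\mathbb E[h(X)]-\mathbb E[h(Y)]\bigr|,\qquad d_{\mathrm K}(X,Y)=\sup_{z\in\mathbb R^d}\bigl|\mathbb P(X\le z)-\mathbb P(Y\le z)\bigr|,$$ where $x\le z$ means $x_j\le z_j$ for all $j$. Let $M'_m=2^{m-2}(m-1)!$ for $1\le m\le 4$, $M'_m=2^{\frac{3m}{2}-2}(m-1)!$ for $m\ge 5$, and $N'_m=2^mM'_m$. **Proposition.** Let $X$ be any random vector in $\mathbb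 R^d$ and let $Y\sim\mathrm{MVN}_d(\mu,\Sigma)$ be multivariate normal with mean $\mu\in\mathbb R^d$ and (symmetric positive semidefinite, possibly singular) covariance matrix $\Sigma$ with $\Sigma_{jj}>0$ for all $1\le j\le d$. Let $\sigma=\min_{1\le j\le d}\sqrt{\Sigma_{jj}}$ be the smallest standard deviation of the components of $Y$. Then $$d_{\mathrm K}(X,Y)\le 2\Bigl(\frac{\sqrt{2\log d}+2}{\sigma}\Bigr)^{\frac{m}{m+1}}\bigl(N'_m\,d_m(X,Y)\bigr)^{\frac1{m+1}}+M'_m\,d_m(X,Y).$$ If moreover $d_m(X,Y)\le\frac{2+\sqrt{2\log d}}{\sigma N'_m}$, or if $m\ge 2$ and $d_m(X,Y)\le\frac{4+2\sqrt{2\log d}}{\sigma M'_m}$, then $$d_{\mathrm K}(X,Y)\le 2\Bigl(\frac{\sqrt{2\log d}+2}{\sigma}\Bigr)^{\frac{m}{m+1}}\bigl(N'_m\,d_m(X,Y)\bigr)^{\frac1{m+1}}.$$ -/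

import Mathlib

open MeasureTheory ProbabilityTheory

/-- The integral probability metric `sup_{h ∈ H} |∫ h dμ - ∫ h dν|` induced by a class `H` of test
functions. It is used below only for classes of measurable functions bounded by one, so that for
probability measures the integrals exist and the supremum is finite
(see `bddAbove_ipm_of_bounded`). -/
noncomputable def ipm {E : Type*} [MeasurableSpace E] (H : Set (E → ℝ)) (μ ν : Measure E) : ℝ :=
  ⨆ h : H, |(∫ x, (h : E → ℝ) x ∂μ) - ∫ x, (h : E → ℝ) x ∂ν|

/-- Indicators of the lower-left orthants `{x | x_j ≤ z_j for all j}`, `z ∈ ℝ^d`. -/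
def kolmogorovClass (d : ℕ) : Set (EuclideanSpace ℝ (Fin d) → ℝ) :=
  {h | ∃ z : EuclideanSpace ℝ (Fin d),
    h = Set.indicator {x : EuclideanSpace ℝ (Fin d) | ∀ j, x j ≤ z j} (fun _ => (1 : ℝ))}

/-- The Kolmogorov distance between two laws on `ℝ^d`. -/
noncomputable def kolmogorovDist {d : ℕ} (μ ν : Measure (EuclideanSpace ℝ (Fin d))) : ℝ :=
  ipm (kolmogorovClass d) μ ν

/-- The `k`-th order partial derivative `∂^k h / ∂x_{i_1} ⋯ ∂x_{i_k}` (for `h` of class `C^k`);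
for `k = 0` it is `h` itself. -/
noncomputable def partialDeriv {d k : ℕ} (h : EuclideanSpace ℝ (Fin d) → ℝ) (i : Fin k → Fin d)
    (x : EuclideanSpace ℝ (Fin d)) : ℝ :=
  iteratedFDeriv ℝ k h x (fun j => EuclideanSpace.single (i j) (1 : ℝ))

/-- For `m ≥ 1`: the functions of class `C^{m-1}` on `ℝ^d` all of whose partial derivatives of
orders `0, …, m-1` are bounded by one in absolute value, and all of whose partial derivatives of
order `m-1` are Lipschitz with constant one for the Euclidean norm. -/
def smoothClass (d m : ℕ) : Set (EuclideanSpace ℝ (Fin d) → ℝ) :=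
  {h | ContDiff ℝ ((m - 1 : ℕ) : WithTop ℕ∞) h ∧
    (∀ k : ℕ, k ≤ m - 1 → ∀ (i : Fin k → Fin d) (x : EuclideanSpace ℝ (Fin d)),
      |partialDeriv h i x| ≤ 1) ∧
    (∀ i : Fin (m - 1) → Fin d, LipschitzWith 1 (partialDeriv h i))}

/-- The smooth Wasserstein distance `d_m` between two laws on `ℝ^d`. -/
noncomputable def smoothDist {d : ℕ} (m : ℕ) (μ ν : Measure (EuclideanSpace ℝ (Fin d))) : ℝ :=
  ipm (smoothClass d m) μ ν

/-- `M'_m = 2^{m-2} (m-1)!` for `1 ≤ m ≤ 4` and `M'_m = 2^{3m/2-2} (m-1)!` for `m ≥ 5`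
(real exponents). -/
noncomputable def constM (m : ℕ) : ℝ :=
  if m ≤ 4 then (2 : ℝ) ^ ((m : ℝ) - 2) * (Nat.factorial (m - 1) : ℝ)
  else (2 : ℝ) ^ (3 * (m : ℝ) / 2 - 2) * (Nat.factorial (m - 1) : ℝ)

/-- `N'_m = 2^m M'_m`. -/
noncomputable def constN (m : ℕ) : ℝ := (2 : ℝ) ^ m * constM m

theorem bddAbove_ipm_of_bounded {E : Type*} [MeasurableSpace E] (H : Set (E → ℝ))
    (hH : ∀ h ∈ H, ∀ x, |h x| ≤ 1) (μ ν : Measure E) [IsProbabilityMeasure μ]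
    [IsProbabilityMeasure ν] :
    BddAbove (Set.range fun h : H => |(∫ x, (h : E → ℝ) x ∂μ) - ∫ x, (h : E → ℝ) x ∂ν|) := by
  have key : ∀ (ρ : Measure E) [IsProbabilityMeasure ρ] (h : H),
      |∫ x, (h : E → ℝ) x ∂ρ| ≤ 1 := by
    intro ρ _ h
    have h1 := norm_integral_le_of_norm_le_const (μ := ρ) (f := (h : E → ℝ)) (C := 1)
      (Filter.Eventually.of_forall fun x => by
        rw [Real.norm_eq_abs]
        exact hH h h.2 x)
    simpa using h1
  refine ⟨2, ?_⟩
  rintro _ ⟨h, rfl⟩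
  have h1 := abs_le.1 (key μ h)
  have h2 := abs_le.1 (key ν h)
  exact abs_le.2 ⟨by linarith, by linarith⟩

theorem abs_le_one_of_mem_kolmogorovClass {d : ℕ} {h : EuclideanSpace ℝ (Fin d) → ℝ}
    (hh : h ∈ kolmogorovClass d) (x : EuclideanSpace ℝ (Fin d)) : |h x| ≤ 1 := by
  obtain ⟨z, rfl⟩ := hh
  by_cases hx : x ∈ {x : EuclideanSpace ℝ (Fin d) | ∀ j, x j ≤ z j}
  · rw [Set.indicator_of_mem hx]
    simp
  · rw [Set.indicator_of_notMem hx]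
    simp

theorem abs_le_one_of_mem_smoothClass {d m : ℕ} {h : EuclideanSpace ℝ (Fin d) → ℝ}
    (hh : h ∈ smoothClass d m) (x : EuclideanSpace ℝ (Fin d)) : |h x| ≤ 1 := by
  have h0 := hh.2.1 0 (Nat.zero_le _) Fin.elim0 x
  simpa [partialDeriv] using h0

/-! The proof is a smoothing argument. Suppose that for each scale α > 0 the indicator of every
orthant can be sandwiched between [0, 1]-valued test functions whose partial derivatives of order
below m are K-Lipschitz, with K = M'_m max(1, (2/α)^m), at a cost of at most Cα in Gaussian
expectation. Then d_K ≤ K d_m + Cα (`kolmogorovDist_le_of_approx`, `kolmogorovDist_le_smoothDist`).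
The choice α^(m+1) = N'_m d_m / C balances the two terms and gives the proposition
(`le_of_forall_scale`); the maximum is the power (2/α)^m as soon as α ≤ 2, which is what the extra
hypotheses ensure.

The constant C = (√(2 log d) + 2)/σ comes from Nazarov's inequality. The event that the largest
coordinate excess falls into a window of length t is split according to the index attaining the
maximum. Conditionally on the part of the vector independent of that coordinate, the event is an
upper set in the coordinate, and the Gaussian hazard rate bounds the mass of a window by the mass
beyond it. The masses beyond belong to disjoint events and sum to at most one
(`measureReal_forall_le_add_le`).

The test functions must have constants free of d, and two constructions are used. For m other than 3
and 4, a linear ramp in max_j (x_j - z_j) is averaged m - 1 times over a cube. Each average gains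
one derivative and costs a factor 1/w, because a translate of the cube differs from it by |t|/w in
total variation (`PartialLip.iterate_boxAvg`). This gives the constant m^m/4, which exceeds M'_m for
m = 3 and m = 4. There a product ∏ F(x_j) of a spline step F is used instead. Its gradient is
bounded uniformly in d because F'^2 ≤ c(1 - F^2), and ∑_j (1 - p_j) ∏_{i≠j} p_i ≤ 1 for numbers p_i
in [0, 1] (`SmoothStep.sum_mul_prod_le`). -/

/-! ### Functions with Lipschitz partial derivatives. -/

/-- The linear form on `ℝ^d` with coefficients `c`. -/
noncomputable def coordForm {d : ℕ} (c : Fin d → ℝ) : EuclideanSpace ℝ (Fin d) →L[ℝ] ℝ :=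
  ∑ j, c j • (EuclideanSpace.proj j : EuclideanSpace ℝ (Fin d) →L[ℝ] ℝ)

theorem coordForm_apply {d : ℕ} (c : Fin d → ℝ) (v : EuclideanSpace ℝ (Fin d)) :
    coordForm c v = ∑ j, c j * v j := by
  simp [coordForm]

/-- `f` is `k` times differentiable, and each of its partial derivatives of order `j ≤ k`
is `B j`-Lipschitz. -/
def PartialLip {d : ℕ} : ℕ → (ℕ → ℝ) → (EuclideanSpace ℝ (Fin d) → ℝ) → Prop
  | 0, B, f => ∀ x y, |f x - f y| ≤ B 0 * dist x y
  | k + 1, B, f => (∀ x y, |f x - f y| ≤ B 0 * dist x y) ∧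
      ∃ g : Fin d → EuclideanSpace ℝ (Fin d) → ℝ,
        (∀ x, HasFDerivAt f (coordForm fun j => g j x) x) ∧
        ∀ j, PartialLip k (fun n => B (n + 1)) (g j)

namespace PartialLip

variable {d : ℕ}

theorem abs_sub_le {k : ℕ} {B : ℕ → ℝ} {f : EuclideanSpace ℝ (Fin d) → ℝ}
    (h : PartialLip k B f) (x y : EuclideanSpace ℝ (Fin d)) : |f x - f y| ≤ B 0 * dist x y := by
  cases k with
  | zero => exact h x y
  | succ k => exact h.1 x y

theorem lipschitzWith {k : ℕ} {B : ℕ → ℝ} {f : EuclideanSpace ℝ (Fin d) → ℝ}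
    (h : PartialLip k B f) : LipschitzWith (B 0).toNNReal f := by
  refine LipschitzWith.of_dist_le_mul fun x y => ?_
  rw [Real.dist_eq]
  refine (h.abs_sub_le x y).trans ?_
  gcongr
  exact Real.le_coe_toNNReal _

theorem contDiff {k : ℕ} {B : ℕ → ℝ} {f : EuclideanSpace ℝ (Fin d) → ℝ}
    (h : PartialLip k B f) : ContDiff ℝ k f := by
  induction k generalizing B f with
  | zero => exact contDiff_zero.2 h.lipschitzWith.continuous
  | succ k ih =>
    obtain ⟨-, g, hg, hgB⟩ := h
    exact contDiff_succ_iff_hasFDerivAt.2 ⟨_, ContDiff.sum fun j _ =>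
      (ih (hgB j)).smul contDiff_const, hg⟩

/-- The last argument of an iterated derivative belongs to the derivative taken first. Peeling off
that index matches the recursion in `PartialLip`. -/
theorem partialDeriv_succ {k : ℕ} {f : EuclideanSpace ℝ (Fin d) → ℝ}
    {g : Fin d → EuclideanSpace ℝ (Fin d) → ℝ}
    (hg : ∀ x, HasFDerivAt f (coordForm fun j => g j x) x)
    (hc : ∀ j, ContDiff ℝ k (g j)) (i : Fin (k + 1) → Fin d) :
    partialDeriv f i = partialDeriv (g (i (Fin.last k))) (Fin.init i) := by
  funext x
  have hf : ContDiff ℝ k (fun y => fderiv ℝ f y) := by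
    have : (fun y => fderiv ℝ f y)
        = fun y => coordForm fun j => g j y :=
      funext fun y => (hg y).fderiv
    rw [this]
    exact ContDiff.sum fun j _ => (hc j).smul contDiff_const
  have hcomp : g (i (Fin.last k)) =
      (ContinuousLinearMap.apply ℝ ℝ (EuclideanSpace.single (i (Fin.last k)) (1 : ℝ))) ∘
        (fun y => fderiv ℝ f y) := by
    funext y
    simp only [Function.comp_apply, ContinuousLinearMap.apply_apply, (hg y).fderiv]
    simp [coordForm_apply]
  unfold partialDeriv
  rw [iteratedFDeriv_succ_apply_right, hcomp,
    ContinuousLinearMap.iteratedFDeriv_comp_left _ hf.contDiffAt le_rfl]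
  rfl

theorem abs_partialDeriv_sub_le {n : ℕ} {B : ℕ → ℝ} {f : EuclideanSpace ℝ (Fin d) → ℝ}
    (h : PartialLip n B f) {k : ℕ} (hk : k ≤ n) (i : Fin k → Fin d)
    (x y : EuclideanSpace ℝ (Fin d)) :
    |partialDeriv f i x - partialDeriv f i y| ≤ B k * dist x y := by
  induction k generalizing n B f with
  | zero => simpa [partialDeriv] using h.abs_sub_le x y
  | succ k ih =>
    obtain ⟨n, rfl⟩ : ∃ n', n = n' + 1 := ⟨n - 1, by omega⟩
    obtain ⟨-, g, hg, hgB⟩ := h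
    rw [partialDeriv_succ hg fun j => (hgB j).contDiff.of_le (by exact_mod_cast by omega)]
    exact ih (hgB _) (by omega) _

theorem abs_partialDeriv_le {n : ℕ} {B : ℕ → ℝ} {f : EuclideanSpace ℝ (Fin d) → ℝ}
    (h : PartialLip n B f) {k : ℕ} (hk : k + 1 ≤ n) (i : Fin (k + 1) → Fin d)
    (x : EuclideanSpace ℝ (Fin d)) : |partialDeriv f i x| ≤ B k := by
  induction k generalizing n B f with
  | zero =>
    obtain ⟨n, rfl⟩ : ∃ n', n = n' + 1 := ⟨n - 1, by omega⟩
    have hB : 0 ≤ B 0 := by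
      have := h.abs_sub_le (EuclideanSpace.single (i 0) (1 : ℝ)) 0
      have h1 : dist (EuclideanSpace.single (i 0) (1 : ℝ)) 0 = 1 := by simp
      rw [h1, mul_one] at this
      exact (abs_nonneg _).trans this
    have hl := norm_fderiv_le_of_lipschitz ℝ (x₀ := x) h.lipschitzWith
    rw [Real.coe_toNNReal _ hB] at hl
    have := (fderiv ℝ f x).le_opNorm (EuclideanSpace.single (i 0) (1 : ℝ))
    rw [PiLp.norm_single, norm_one, mul_one] at this
    simpa [partialDeriv] using this.trans hl
  | succ k ih =>
    obtain ⟨n, rfl⟩ : ∃ n', n = n' + 1 := ⟨n - 1, by omega⟩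
    obtain ⟨-, g, hg, hgB⟩ := h
    rw [partialDeriv_succ hg fun j => (hgB j).contDiff.of_le (by exact_mod_cast by omega)]
    exact ih (hgB _) (by omega) _

/-- Every derivative brings out a factor `t`, and the Lipschitz estimate one more. The constant `b`
dies with the first derivative, so the induction must allow `a` and `b` to vary. -/
theorem affine {k : ℕ} {B : ℕ → ℝ} {f : EuclideanSpace ℝ (Fin d) → ℝ}
    (h : PartialLip k B f) (a b : ℝ) {t : ℝ} (ht : 0 ≤ t) (c : EuclideanSpace ℝ (Fin d)) :
    PartialLip k (fun n => |a| * t ^ (n + 1) * B n) (fun x => a * f (t • (x - c)) + b) := by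
  have lip (k : ℕ) (B : ℕ → ℝ) (f : EuclideanSpace ℝ (Fin d) → ℝ) (h : PartialLip k B f) (a b : ℝ)
      (x y : EuclideanSpace ℝ (Fin d)) :
      |(a * f (t • (x - c)) + b) - (a * f (t • (y - c)) + b)| ≤ |a| * t ^ (0 + 1) * B 0 * dist x y := by
    have h1 : (a * f (t • (x - c)) + b) - (a * f (t • (y - c)) + b)
        = a * (f (t • (x - c)) - f (t • (y - c))) := by ring
    have h2 : dist (t • (x - c)) (t • (y - c)) = t * dist x y := by
      rw [dist_smul₀, dist_sub_right, Real.norm_of_nonneg ht]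
    have := h.abs_sub_le (t • (x - c)) (t • (y - c))
    rw [h2] at this
    rw [h1, abs_mul]
    calc |a| * |f (t • (x - c)) - f (t • (y - c))| ≤ |a| * (B 0 * (t * dist x y)) := by gcongr
      _ = _ := by ring
  induction k generalizing B f a b with
  | zero => exact lip 0 B f h a b
  | succ k ih =>
    refine ⟨lip _ B f h a b, ?_⟩
    obtain ⟨-, g, hg, hgB⟩ := h
    refine ⟨fun j x => (a * t) * g j (t • (x - c)) + 0, fun x => ?_, fun j => ?_⟩
    · have h1 : HasFDerivAt (fun x : EuclideanSpace ℝ (Fin d) => t • (x - c))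
          (t • ContinuousLinearMap.id ℝ _) x := ((hasFDerivAt_id x).sub_const c).const_smul t
      have h2 := (((hg (t • (x - c))).comp x h1).const_mul a).add_const b
      refine h2.congr_fderiv ?_
      ext1 v
      simp only [coordForm_apply, smul_apply, ContinuousLinearMap.comp_apply,
        ContinuousLinearMap.id_apply, smul_eq_mul, Finset.mul_sum, PiLp.smul_apply]
      exact Finset.sum_congr rfl fun j _ => by ring
    · convert ih (hgB j) (a * t) 0 using 1
      funext n
      rw [abs_mul, abs_of_nonneg ht]
      ring

/-- A Lipschitz bound for the partial derivatives of order k - 1 bounds those of order k, so only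
the bound on `f` itself has to be supplied separately. -/
theorem mem_smoothClass {m : ℕ} {B : ℕ → ℝ} {f : EuclideanSpace ℝ (Fin d) → ℝ}
    (h : PartialLip (m - 1) B f) (hf : ∀ x, |f x| ≤ 1) (hB : ∀ k ≤ m - 1, B k ≤ 1) :
    f ∈ smoothClass d m := by
  refine ⟨h.contDiff, fun k hk i x => ?_, fun i => LipschitzWith.of_dist_le_mul fun x y => ?_⟩
  · cases k with
    | zero => simpa [partialDeriv] using hf x
    | succ k => exact (h.abs_partialDeriv_le hk i x).trans (hB k (by omega))
  · rw [Real.dist_eq]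
    refine (h.abs_partialDeriv_sub_le le_rfl i x y).trans ?_
    gcongr
    exact_mod_cast hB _ le_rfl

/-- Test functions with values in `[0, 1]` and Lipschitz bounds at most `K ≥ 1/2` have expectations
that differ by at most `K` times the smooth distance. -/
theorem abs_integral_sub_le {m : ℕ} {B : ℕ → ℝ} {f : EuclideanSpace ℝ (Fin d) → ℝ}
    (h : PartialLip (m - 1) B f) (hf : ∀ x, f x ∈ Set.Icc (0 : ℝ) 1) {K : ℝ} (hK : 1 / 2 ≤ K)
    (hB : ∀ k ≤ m - 1, B k ≤ K) (μ ν : Measure (EuclideanSpace ℝ (Fin d)))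
    [IsProbabilityMeasure μ] [IsProbabilityMeasure ν] :
    |∫ x, f x ∂μ - ∫ x, f x ∂ν| ≤ K * smoothDist m μ ν := by
  have hK0 : 0 < K := by linarith
  have hint (ρ : Measure (EuclideanSpace ℝ (Fin d))) [IsProbabilityMeasure ρ] :
      Integrable f ρ := by
    refine Integrable.of_bound (C := 1) h.lipschitzWith.continuous.aestronglyMeasurable
      (Filter.Eventually.of_forall fun x => ?_)
    rw [Real.norm_eq_abs, abs_le]
    constructor <;> linarith [(hf x).1, (hf x).2]
  -- Subtracting 1/2 centres `f` in [-1/2, 1/2], so dividing by `K ≥ 1/2` is enough for the sup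
  -- bound. This is sharp for m = 1, where M'_1 = 1/2.
  have hmem : (fun x => K⁻¹ * f ((1 : ℝ) • (x - 0)) + -(K⁻¹ * (1 / 2))) ∈ smoothClass d m := by
    refine (h.affine K⁻¹ _ zero_le_one 0).mem_smoothClass (fun x => ?_) fun k hk => ?_
    · have h1 : K⁻¹ * f ((1 : ℝ) • (x - 0)) + -(K⁻¹ * (1 / 2)) = K⁻¹ * (f x - 1 / 2) := by
        simp only [one_smul, sub_zero]; ring
      rw [h1, abs_mul, abs_of_pos (inv_pos.2 hK0), inv_mul_le_one₀ hK0, abs_le]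
      constructor <;> linarith [(hf x).1, (hf x).2]
    · rw [abs_of_pos (inv_pos.2 hK0), one_pow, mul_one, inv_mul_le_one₀ hK0]
      exact hB k hk
  have hle := le_ciSup (bddAbove_ipm_of_bounded (smoothClass d m)
    (fun _ hh => abs_le_one_of_mem_smoothClass hh) μ ν) ⟨_, hmem⟩
  have hi (ρ : Measure (EuclideanSpace ℝ (Fin d))) [IsProbabilityMeasure ρ] :
      ∫ x, (K⁻¹ * f ((1 : ℝ) • (x - 0)) + -(K⁻¹ * (1 / 2))) ∂ρ
        = K⁻¹ * ∫ x, f x ∂ρ - K⁻¹ * (1 / 2) := by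
    simp only [one_smul, sub_zero]
    rw [integral_add ((hint ρ).const_mul _) (integrable_const _), integral_const_mul]
    simp [sub_eq_add_neg]
  simp only [hi] at hle
  have h1 : K⁻¹ * ∫ x, f x ∂μ - K⁻¹ * (1 / 2) - (K⁻¹ * ∫ x, f x ∂ν - K⁻¹ * (1 / 2))
      = K⁻¹ * (∫ x, f x ∂μ - ∫ x, f x ∂ν) := by ring
  rw [h1, abs_mul, abs_of_pos (inv_pos.2 hK0), inv_mul_le_iff₀ hK0] at hle
  exact hle

end PartialLip

/-! ### Averaging over cubes. -/

/-- The cube `[-w, w]^d`. -/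
def cube (d : ℕ) (w : ℝ) : Set (EuclideanSpace ℝ (Fin d)) := {u | ∀ j, u j ∈ Set.Icc (-w) w}

theorem setOf_forall_mem_Icc_eq {d : ℕ} (a b : Fin d → ℝ) :
    {u : EuclideanSpace ℝ (Fin d) | ∀ j, u j ∈ Set.Icc (a j) (b j)}
      = (EuclideanSpace.equiv (Fin d) ℝ) ⁻¹' Set.Icc a b := by
  ext u
  simp [Set.mem_Icc, Pi.le_def, forall_and]

theorem volume_setOf_forall_mem_Icc {d : ℕ} (a b : Fin d → ℝ) :
    volume {u : EuclideanSpace ℝ (Fin d) | ∀ j, u j ∈ Set.Icc (a j) (b j)}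
      = ∏ j, ENNReal.ofReal (b j - a j) := by
  rw [setOf_forall_mem_Icc_eq]
  exact ((PiLp.volume_preserving_ofLp (Fin d)).measure_preimage
    measurableSet_Icc.nullMeasurableSet).trans Real.volume_Icc_pi

theorem isCompact_cube (d : ℕ) (w : ℝ) : IsCompact (cube d w) := by
  rw [cube, setOf_forall_mem_Icc_eq]
  exact (EuclideanSpace.equiv (Fin d) ℝ).toHomeomorph.isCompact_preimage.2 isCompact_Icc

theorem measurableSet_cube (d : ℕ) (w : ℝ) : MeasurableSet (cube d w) :=
  (isCompact_cube d w).isClosed.measurableSet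

theorem volume_cube (d : ℕ) (w : ℝ) : volume (cube d w) = ENNReal.ofReal (2 * w) ^ d := by
  rw [cube, volume_setOf_forall_mem_Icc]
  simp [two_mul]

theorem volume_real_cube (d : ℕ) {w : ℝ} (hw : 0 < w) : volume.real (cube d w) = (2 * w) ^ d := by
  rw [Measure.real, volume_cube, ENNReal.toReal_pow, ENNReal.toReal_ofReal (by positivity)]

/-- The uniform distribution on the cube `[-w, w]^d`. -/
noncomputable def cubeUnif (d : ℕ) (w : ℝ) : Measure (EuclideanSpace ℝ (Fin d)) :=
  (volume : Measure (EuclideanSpace ℝ (Fin d)))[|cube d w]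

theorem isProbabilityMeasure_cubeUnif (d : ℕ) {w : ℝ} (hw : 0 < w) :
    IsProbabilityMeasure (cubeUnif d w) := by
  refine cond_isProbabilityMeasure_of_finite ?_ (isCompact_cube d w).measure_lt_top.ne
  rw [volume_cube]
  exact pow_ne_zero _ (by simpa using hw)

theorem ae_mem_cube (d : ℕ) (w : ℝ) : ∀ᵐ u ∂cubeUnif d w, u ∈ cube d w :=
  ae_cond_mem (measurableSet_cube d w)

theorem integrable_cubeUnif {d : ℕ} {w : ℝ} (hw : 0 < w) {f : EuclideanSpace ℝ (Fin d) → ℝ}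
    (hf : Continuous f) : Integrable f (cubeUnif d w) := by
  refine Integrable.smul_measure (hf.continuousOn.integrableOn_compact (isCompact_cube d w)) ?_
  rw [volume_cube]
  exact ENNReal.inv_ne_top.2 (pow_ne_zero _ (by simpa using hw))

theorem integral_cubeUnif {d : ℕ} {w : ℝ} (hw : 0 < w) (f : EuclideanSpace ℝ (Fin d) → ℝ) :
    ∫ u, f u ∂cubeUnif d w = ((2 * w) ^ d)⁻¹ * ∫ u in cube d w, f u := by
  rw [cubeUnif, ProbabilityTheory.cond, integral_smul_measure, ENNReal.toReal_inv, ← Measure.real,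
    volume_real_cube d hw, smul_eq_mul]

/-- A translation by `t` in a coordinate direction moves the uniform distribution on
`[-w, w]^d` by at most `|t| / w` in total variation. -/
theorem abs_integral_translate_sub_le {d : ℕ} {w : ℝ} (hw : 0 < w)
    {F : EuclideanSpace ℝ (Fin d) → ℝ} (hF : Continuous F) {K : ℝ} (hK : ∀ u, |F u| ≤ K)
    (j : Fin d) (t : ℝ) :
    |∫ u, F (u + EuclideanSpace.single j t) ∂cubeUnif d w - ∫ u, F u ∂cubeUnif d w|
      ≤ K / w * |t| := by
  have hK0 : 0 ≤ K := (abs_nonneg _).trans (hK 0)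
  -- A negative translation is a positive one applied to the translated function, with the two
  -- integrals exchanged.
  wlog ht : 0 ≤ t generalizing F t
  · have h := this (F := fun u => F (u + EuclideanSpace.single j t))
      (hF.comp (continuous_add_const _)) (fun u => hK _) (-t) (by linarith)
    have e (u : EuclideanSpace ℝ (Fin d)) :
        u + EuclideanSpace.single j (-t) + EuclideanSpace.single j t = u := by
      ext i
      by_cases hi : i = j <;> simp [hi]
    simp only [e] at h
    rwa [abs_sub_comm, abs_neg] at h
  set a : EuclideanSpace ℝ (Fin d) := EuclideanSpace.single j t with ha
  set A : Set (EuclideanSpace ℝ (Fin d)) := (fun u => u + -a) ⁻¹' cube d w with hA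
  have hmA : MeasurableSet A := (measurable_add_const (-a)) (measurableSet_cube d w)
  have hcA : IsCompact A := (Homeomorph.addRight (-a)).isCompact_preimage.2 (isCompact_cube d w)
  have htrans : ∫ u in cube d w, F (u + a) = ∫ u in A, F u := by
    have := (measurePreserving_add_right (volume : Measure (EuclideanSpace ℝ (Fin d)))
      (-a)).setIntegral_preimage_emb (MeasurableEquiv.addRight (-a)).measurableEmbedding
      (fun u => F (u + a)) (cube d w)
    rw [← this]
    simp [hA]
  -- Either half of the symmetric difference of the cube and its translate lies in a slab of
  -- thickness `t` in direction `j`. Its volume t(2w)^(d-1) is written so as to avoid d - 1.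
  have box (s : Set (EuclideanSpace ℝ (Fin d))) (lo : ℝ)
      (hs : s ⊆ {u | ∀ i, u i ∈ Set.Icc (if i = j then lo else -w) (if i = j then lo + t else w)}) :
      |∫ u in s, F u| ≤ K * (t / (2 * w) * (2 * w) ^ d) := by
    have hvol : volume {u : EuclideanSpace ℝ (Fin d) | ∀ i, u i ∈
        Set.Icc (if i = j then lo else -w) (if i = j then lo + t else w)}
        = ENNReal.ofReal (t / (2 * w) * (2 * w) ^ d) := by
      rw [volume_setOf_forall_mem_Icc, ← ENNReal.ofReal_prod_of_nonneg]
      · congr 1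
        have : ∀ i : Fin d, (if i = j then lo + t else w) - (if i = j then lo else -w)
            = (if i = j then t / (2 * w) else 1) * (2 * w) := by
          intro i
          split_ifs
          · field_simp; ring
          · ring
        rw [Finset.prod_congr rfl fun i _ => this i, Finset.prod_mul_distrib,
          Finset.prod_ite_eq' Finset.univ j, if_pos (Finset.mem_univ j), Finset.prod_const,
          Finset.card_univ, Fintype.card_fin]
      · intro i _
        split_ifs <;> linarith
    have hle : volume.real s ≤ t / (2 * w) * (2 * w) ^ d := by
      refine ENNReal.toReal_le_of_le_ofReal (by positivity) ?_
      rw [← hvol]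
      exact measure_mono hs
    have hfin : volume s < ⊤ := by
      refine (measure_mono hs).trans_lt ?_
      rw [hvol]
      exact ENNReal.ofReal_lt_top
    have := norm_setIntegral_le_of_norm_le_const (f := F) (C := K) hfin fun u _ => hK u
    rw [Real.norm_eq_abs] at this
    exact this.trans (by gcongr)
  have hd1 : |∫ u in A \ cube d w, F u| ≤ K * (t / (2 * w) * (2 * w) ^ d) := by
    refine box _ w ?_
    rintro u ⟨hu, hu'⟩ i
    have hu2 : ∀ i, i ≠ j → u i ∈ Set.Icc (-w) w := fun i hi => by
      simpa [ha, hi] using hu i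
    have hu3 : u j - t ∈ Set.Icc (-w) w := by simpa [ha, sub_eq_add_neg] using hu j
    by_cases hi : i = j
    · subst hi
      simp only [if_true]
      refine ⟨?_, by linarith [hu3.2]⟩
      by_contra hlt
      refine hu' fun l => ?_
      by_cases hl : l = i
      · subst hl
        exact ⟨by linarith [hu3.1], by linarith⟩
      · exact hu2 l hl
    · simpa [hi] using hu2 i hi
  have hd2 : |∫ u in cube d w \ A, F u| ≤ K * (t / (2 * w) * (2 * w) ^ d) := by
    refine box _ (-w) ?_
    rintro u ⟨hu, hu'⟩ i
    by_cases hi : i = j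
    · subst hi
      simp only [if_true]
      refine ⟨(hu i).1, ?_⟩
      by_contra hlt
      refine hu' fun l => ?_
      by_cases hl : l = i
      · subst hl
        have : u l - t ∈ Set.Icc (-w) w := ⟨by linarith, by linarith [(hu l).2]⟩
        simpa [ha, sub_eq_add_neg] using this
      · simpa [ha, hl] using hu l
    · simpa [hi] using hu i
  have h1 := integral_inter_add_sdiff (f := F) (measurableSet_cube d w)
    (hF.continuousOn.integrableOn_compact (μ := volume) hcA)
  have h2 := integral_inter_add_sdiff (f := F) hmA
    (hF.continuousOn.integrableOn_compact (μ := volume) (isCompact_cube d w))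
  rw [Set.inter_comm] at h2
  rw [integral_cubeUnif hw, integral_cubeUnif hw, htrans, ← mul_sub, abs_mul,
    abs_of_pos (by positivity : 0 < ((2 * w) ^ d)⁻¹), abs_of_nonneg ht]
  have h3 : |(∫ u in A, F u) - ∫ u in cube d w, F u| ≤ 2 * (K * (t / (2 * w) * (2 * w) ^ d)) := by
    have : (∫ u in A, F u) - ∫ u in cube d w, F u
        = (∫ u in A \ cube d w, F u) - ∫ u in cube d w \ A, F u := by linarith
    rw [this]
    exact (abs_sub _ _).trans (by linarith)
  rw [inv_mul_le_iff₀ (by positivity)]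
  refine h3.trans (le_of_eq ?_)
  field_simp

/-- The average of `f` over the translates of the cube `[-w, w]^d`. -/
noncomputable def boxAvg {d : ℕ} (w : ℝ) (f : EuclideanSpace ℝ (Fin d) → ℝ)
    (x : EuclideanSpace ℝ (Fin d)) : ℝ :=
  ∫ u, f (x + u) ∂cubeUnif d w

section boxAvg

variable {d : ℕ} {w : ℝ} {f : EuclideanSpace ℝ (Fin d) → ℝ}

theorem boxAvg_mem_Icc (hw : 0 < w) (hf : Continuous f) {x : EuclideanSpace ℝ (Fin d)} {a b : ℝ}
    (h : ∀ u ∈ cube d w, f (x + u) ∈ Set.Icc a b) : boxAvg w f x ∈ Set.Icc a b := by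
  have := isProbabilityMeasure_cubeUnif d hw
  have hi : Integrable (fun u => f (x + u)) (cubeUnif d w) :=
    integrable_cubeUnif hw (hf.comp (continuous_const_add x))
  constructor
  · have := integral_mono_ae (integrable_const a) hi
      ((ae_mem_cube d w).mono fun u hu => (h u hu).1)
    simpa [boxAvg] using this
  · have := integral_mono_ae hi (integrable_const b)
      ((ae_mem_cube d w).mono fun u hu => (h u hu).2)
    simpa [boxAvg] using this

theorem abs_boxAvg_sub_le (hw : 0 < w) {L : ℝ} (hf : PartialLip 0 (fun _ => L) f)
    (x y : EuclideanSpace ℝ (Fin d)) : |boxAvg w f x - boxAvg w f y| ≤ L * dist x y := by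
  have := isProbabilityMeasure_cubeUnif d hw
  have hi (x : EuclideanSpace ℝ (Fin d)) : Integrable (fun u => f (x + u)) (cubeUnif d w) :=
    integrable_cubeUnif hw (hf.lipschitzWith.continuous.comp (continuous_const_add x))
  rw [boxAvg, boxAvg, ← integral_sub (hi x) (hi y)]
  have := norm_integral_le_of_norm_le_const (μ := cubeUnif d w) (C := L * dist x y)
    (f := fun u => f (x + u) - f (y + u)) (Filter.Eventually.of_forall fun u => by
      have := hf.abs_sub_le (x + u) (y + u)
      rwa [dist_add_right] at this)
  simpa using this

/-- By Rademacher's theorem a Lipschitz function is differentiable almost everywhere. That suffices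
for differentiation under the integral, as the law of the translation has a density and the
Lipschitz constant dominates. -/
theorem hasFDerivAt_boxAvg (hw : 0 < w) {L : ℝ} (hf : PartialLip 0 (fun _ => L) f)
    (x : EuclideanSpace ℝ (Fin d)) :
    Integrable (fun u => fderiv ℝ f (x + u)) (cubeUnif d w) ∧
    HasFDerivAt (boxAvg w f) (∫ u, fderiv ℝ f (x + u) ∂cubeUnif d w) x := by
  have := isProbabilityMeasure_cubeUnif d hw
  have hc := hf.lipschitzWith.continuous
  have hdiff : ∀ᵐ u ∂cubeUnif d w, DifferentiableAt ℝ f (x + u) :=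
    cond_absolutelyContinuous.ae_le <|
      (measurePreserving_add_left (volume : Measure (EuclideanSpace ℝ (Fin d)))
        x).quasiMeasurePreserving.ae hf.lipschitzWith.ae_differentiableAt
  refine hasFDerivAt_integral_of_dominated_loc_of_lip (bound := fun _ => L) (s := Set.univ)
    Filter.univ_mem (Filter.Eventually.of_forall fun y =>
      (hc.comp (continuous_const_add y)).aestronglyMeasurable)
    (integrable_cubeUnif hw (hc.comp (continuous_const_add x)))
    ((measurable_fderiv ℝ f).comp (measurable_const_add x)).aestronglyMeasurable
    (Filter.Eventually.of_forall fun u => ?_) (integrable_const L) (hdiff.mono fun u hu => ?_)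
  · refine LipschitzOnWith.of_dist_le_mul fun y _ z _ => ?_
    have := hf.abs_sub_le (y + u) (z + u)
    rw [dist_add_right] at this
    refine this.trans ?_
    gcongr
    exact le_abs_self L
  · have := hu.hasFDerivAt.comp x ((hasFDerivAt_id x).add_const u)
    rw [ContinuousLinearMap.comp_id] at this
    exact this

/-- Here the extra derivative is gained. The function u ↦ f(x + u) - f(y + u) is bounded by L·dist x
y, so moving the cube by t changes its average by at most that bound times |t|/w; letting t → 0
compares the derivatives at `x` and `y`. -/
theorem abs_fderiv_boxAvg_sub_le (hw : 0 < w) {L : ℝ} (hf : PartialLip 0 (fun _ => L) f)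
    (j : Fin d) (x y : EuclideanSpace ℝ (Fin d)) :
    |fderiv ℝ (boxAvg w f) x (EuclideanSpace.single j 1)
      - fderiv ℝ (boxAvg w f) y (EuclideanSpace.single j 1)| ≤ L / w * dist x y := by
  have hc := hf.lipschitzWith.continuous
  have hline (x : EuclideanSpace ℝ (Fin d)) :
      HasDerivAt (fun t : ℝ => boxAvg w f (x + t • EuclideanSpace.single j (1 : ℝ)))
        (fderiv ℝ (boxAvg w f) x (EuclideanSpace.single j 1)) 0 :=
    (hasFDerivAt_boxAvg hw hf x).2.differentiableAt.hasFDerivAt.hasLineDerivAt _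
  have hb (u : EuclideanSpace ℝ (Fin d)) : |f (x + u) - f (y + u)| ≤ L * dist x y := by
    have := hf.abs_sub_le (x + u) (y + u)
    rwa [dist_add_right] at this
  have hL : 0 ≤ L * dist x y := (abs_nonneg _).trans (hb 0)
  refine ((hline x).sub (hline y)).le_of_lip' (C := L / w * dist x y)
    (by rw [div_mul_eq_mul_div]; positivity) (Filter.Eventually.of_forall fun t => ?_)
  have hi (x : EuclideanSpace ℝ (Fin d)) : Integrable (fun u => f (x + u)) (cubeUnif d w) :=
    integrable_cubeUnif hw (hc.comp (continuous_const_add x))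
  have hcF : Continuous fun u => f (x + u) - f (y + u) :=
    (hc.comp (continuous_const_add x)).sub (hc.comp (continuous_const_add y))
  have key := abs_integral_translate_sub_le hw hcF hb j t
  have e1 (x u : EuclideanSpace ℝ (Fin d)) :
      x + (u + EuclideanSpace.single j t) = x + t • EuclideanSpace.single j (1 : ℝ) + u := by
    have : EuclideanSpace.single j t = t • EuclideanSpace.single j (1 : ℝ) := by
      ext i
      by_cases hi : i = j <;> simp [hi]
    rw [this]
    abel
  simp only [e1] at key
  rw [integral_sub (hi _) (hi _), integral_sub (hi _) (hi _)] at key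
  rw [Real.norm_eq_abs, Real.norm_eq_abs, sub_zero]
  refine le_trans (le_of_eq ?_) (key.trans (le_of_eq (by ring)))
  simp [boxAvg]

/-- Averaging commutes with differentiation as long as derivatives exist; the gain occurs at the
bottom of the recursion, where the function is merely Lipschitz. Passing to a partial derivative
replaces `L` by `L / w`. -/
theorem PartialLip.boxAvg (hw : 0 < w) {k : ℕ} {L : ℝ}
    (hf : PartialLip k (fun n => L / w ^ n) f) :
    PartialLip (k + 1) (fun n => L / w ^ n) (boxAvg w f) := by
  induction k generalizing L f with
  | zero =>
    have hf0 : PartialLip 0 (fun _ => L) f := fun x y => by simpa using hf x y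
    refine ⟨fun x y => by simpa using abs_boxAvg_sub_le hw hf0 x y,
      fun j x => fderiv ℝ (_root_.boxAvg w f) x (EuclideanSpace.single j 1), fun x => ?_,
      fun j x y => by simpa using abs_fderiv_boxAvg_sub_le hw hf0 j x y⟩
    refine (hasFDerivAt_boxAvg hw hf0 x).2.differentiableAt.hasFDerivAt.congr_fderiv ?_
    ext1 v
    have hv : v = ∑ j, v j • EuclideanSpace.single j (1 : ℝ) := by
      ext i
      simp [Pi.single_apply]
    conv_lhs => rw [hv]
    simp [coordForm_apply, map_sum, mul_comm]
  | succ k ih =>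
    have hf0 : PartialLip 0 (fun _ => L) f := fun x y => by simpa using hf.abs_sub_le x y
    refine ⟨fun x y => by simpa using abs_boxAvg_sub_le hw hf0 x y, ?_⟩
    obtain ⟨-, g, hg, hgB⟩ := hf
    refine ⟨fun j => _root_.boxAvg w (g j), fun x => ?_, fun j => ?_⟩
    · obtain ⟨hint, hder⟩ := hasFDerivAt_boxAvg hw hf0 x
      refine hder.congr_fderiv ?_
      ext1 v
      rw [ContinuousLinearMap.integral_apply hint, coordForm_apply]
      simp only [(hg _).fderiv, coordForm_apply, _root_.boxAvg]
      have hi (j : Fin d) : Integrable (fun u => g j (x + u) * v j) (cubeUnif d w) :=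
        (integrable_cubeUnif hw
          ((hgB j).lipschitzWith.continuous.comp (continuous_const_add x))).mul_const _
      rw [integral_finsetSum _ fun j _ => hi j]
      simp only [integral_mul_const]
    · have e : (fun n => L / w ^ (n + 1)) = fun n => L / w / w ^ n := by
        funext n
        rw [pow_succ', div_div]
      have := hgB j
      rw [e] at this ⊢
      exact ih this

theorem PartialLip.iterate_boxAvg (hw : 0 < w) {L : ℝ} (hf : PartialLip 0 (fun _ => L) f) (r : ℕ) :
    PartialLip r (fun n => L / w ^ n) ((_root_.boxAvg w)^[r] f) := by
  induction r with
  | zero => exact fun x y => by simpa using hf x y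
  | succ r ih =>
    rw [Function.iterate_succ_apply']
    exact ih.boxAvg hw

end boxAvg

/-! ### Reduction to sandwiching test functions. -/

/-- The lower-left orthant `{x | x_j ≤ z_j for all j}`. -/
def orthant {d : ℕ} (z : EuclideanSpace ℝ (Fin d)) : Set (EuclideanSpace ℝ (Fin d)) :=
  {x | ∀ j, x j ≤ z j}

theorem measurableSet_orthant {d : ℕ} (z : EuclideanSpace ℝ (Fin d)) :
    MeasurableSet (orthant z) := by
  simp only [orthant, Set.ofPred_forall]
  exact MeasurableSet.iInter fun j => measurableSet_le (by fun_prop) (by fun_prop)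

/-- The point `z + t (1, …, 1)`. -/
noncomputable def diagShift {d : ℕ} (z : EuclideanSpace ℝ (Fin d)) (t : ℝ) :
    EuclideanSpace ℝ (Fin d) := WithLp.toLp 2 fun j => z j + t

@[simp] theorem diagShift_apply {d : ℕ} (z : EuclideanSpace ℝ (Fin d)) (t : ℝ) (j : Fin d) :
    diagShift z t j = z j + t := rfl

/-- A test function of smoothness `m` with Lipschitz bounds at most `K` that dominates the indicator
of the orthant below `z` at an additional cost of at most `c` in `ν`-expectation. -/
def HasUpperApprox {d : ℕ} (m : ℕ) (K : ℝ) (ν : Measure (EuclideanSpace ℝ (Fin d)))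
    (z : EuclideanSpace ℝ (Fin d)) (c : ℝ) : Prop :=
  ∃ (h : EuclideanSpace ℝ (Fin d) → ℝ) (B : ℕ → ℝ), PartialLip (m - 1) B h ∧
    (∀ k ≤ m - 1, B k ≤ K) ∧ (∀ x, h x ∈ Set.Icc (0 : ℝ) 1) ∧ (∀ x ∈ orthant z, 1 ≤ h x) ∧
    ∫ x, h x ∂ν ≤ ν.real (orthant z) + c

/-- A test function of smoothness `m` with Lipschitz bounds at most `K` that is dominated by the
indicator of the orthant below `z` at a loss of at most `c` in `ν`-expectation. -/
def HasLowerApprox {d : ℕ} (m : ℕ) (K : ℝ) (ν : Measure (EuclideanSpace ℝ (Fin d)))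
    (z : EuclideanSpace ℝ (Fin d)) (c : ℝ) : Prop :=
  ∃ (h : EuclideanSpace ℝ (Fin d) → ℝ) (B : ℕ → ℝ), PartialLip (m - 1) B h ∧
    (∀ k ≤ m - 1, B k ≤ K) ∧ (∀ x, h x ∈ Set.Icc (0 : ℝ) 1) ∧ (∀ x ∉ orthant z, h x ≤ 0) ∧
    ν.real (orthant z) - c ≤ ∫ x, h x ∂ν

/-- For the upper estimate, μ(orthant) ≤ ∫ h dμ ≤ ∫ h dν + K d_m ≤ ν(orthant) + c + K d_m. The lower
estimate is the mirror image. -/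
theorem kolmogorovDist_le_of_approx {d m : ℕ} {K c : ℝ} (hK : 1 / 2 ≤ K)
    (μ ν : Measure (EuclideanSpace ℝ (Fin d))) [IsProbabilityMeasure μ] [IsProbabilityMeasure ν]
    (hU : ∀ z, HasUpperApprox m K ν z c) (hL : ∀ z, HasLowerApprox m K ν z c) :
    kolmogorovDist μ ν ≤ K * smoothDist m μ ν + c := by
  have : Nonempty (kolmogorovClass d) := ⟨⟨_, 0, rfl⟩⟩
  have hint {h : EuclideanSpace ℝ (Fin d) → ℝ} {B : ℕ → ℝ} (hh : PartialLip (m - 1) B h)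
      (h01 : ∀ x, h x ∈ Set.Icc (0 : ℝ) 1) : Integrable h μ := by
    refine Integrable.of_bound (C := 1) hh.lipschitzWith.continuous.aestronglyMeasurable
      (Filter.Eventually.of_forall fun x => ?_)
    rw [Real.norm_eq_abs, abs_le]
    constructor <;> linarith [(h01 x).1, (h01 x).2]
  refine ciSup_le fun ⟨_, z, rfl⟩ => ?_
  have e (ρ : Measure (EuclideanSpace ℝ (Fin d))) :
      ∫ x, (Set.indicator {x : EuclideanSpace ℝ (Fin d) | ∀ j, x j ≤ z j} fun _ => (1 : ℝ)) x ∂ρ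
        = ρ.real (orthant z) := integral_indicator_one (measurableSet_orthant z)
  have hind : Integrable (Set.indicator (orthant z) fun _ => (1 : ℝ)) μ :=
    (integrable_const 1).indicator (measurableSet_orthant z)
  simp only [e]
  rw [abs_le]
  constructor
  · obtain ⟨h, B, hh, hB, h01, hz, hν⟩ := hL z
    have h1 := (abs_le.1 (hh.abs_integral_sub_le h01 hK hB μ ν)).1
    have h2 : ∫ x, h x ∂μ ≤ μ.real (orthant z) := by
      rw [← integral_indicator_one (measurableSet_orthant z)]
      refine integral_mono (hint hh h01) hind fun x => ?_
      by_cases hx : x ∈ orthant z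
      · simpa [hx] using (h01 x).2
      · simpa [hx] using hz x hx
    linarith
  · obtain ⟨h, B, hh, hB, h01, hz, hν⟩ := hU z
    have h1 := (abs_le.1 (hh.abs_integral_sub_le h01 hK hB μ ν)).2
    have h2 : μ.real (orthant z) ≤ ∫ x, h x ∂μ := by
      rw [← integral_indicator_one (measurableSet_orthant z)]
      refine integral_mono hind (hint hh h01) fun x => ?_
      by_cases hx : x ∈ orthant z
      · simpa [hx] using hz x hx
      · simpa [hx] using (h01 x).1
    linarith

/-! ### The maximal coordinate excess. -/

/-- The largest excess of a coordinate of `x` over that of `z`. -/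
noncomputable def excess {d : ℕ} (z x : EuclideanSpace ℝ (Fin d)) : ℝ := ⨆ j, (x j - z j)

section excess

variable {d : ℕ} [Nonempty (Fin d)] {z : EuclideanSpace ℝ (Fin d)}

/-- Sublevel sets of the excess are orthants moved along the diagonal, so anti-concentration in the
diagonal direction is all that functions of the excess require. -/
theorem excess_le_iff {x : EuclideanSpace ℝ (Fin d)} {t : ℝ} :
    excess z x ≤ t ↔ x ∈ orthant (diagShift z t) := by
  rw [excess, ciSup_le_iff (Set.finite_range _).bddAbove]
  simp only [orthant, diagShift_apply, Set.mem_ofPred_eq, sub_le_iff_le_add']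

theorem excess_nonpos_iff {x : EuclideanSpace ℝ (Fin d)} : excess z x ≤ 0 ↔ x ∈ orthant z := by
  simp [excess_le_iff, orthant]

theorem excess_le_add {w : ℝ} {x y : EuclideanSpace ℝ (Fin d)} (h : ∀ j, y j - x j ≤ w) :
    excess z y ≤ excess z x + w := by
  refine ciSup_le fun j => ?_
  have := le_ciSup (Set.finite_range fun j => x j - z j).bddAbove j
  have h1 := h j
  unfold excess
  linarith

/-- The excess is 1-Lipschitz in the sup norm, so a cube of half-width `w` moves it by `w` only,
with no factor √d. -/
theorem excess_add_mem_Icc {w : ℝ} {x u : EuclideanSpace ℝ (Fin d)} (hu : u ∈ cube d w) :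
    excess z (x + u) ∈ Set.Icc (excess z x - w) (excess z x + w) := by
  constructor
  · have := excess_le_add (z := z) (w := w) (x := x + u) (y := x) fun j => by
      have := (hu j).1
      simp only [PiLp.add_apply]
      linarith
    linarith
  · exact excess_le_add fun j => by
      have := (hu j).2
      simp only [PiLp.add_apply]
      linarith

theorem abs_excess_sub_le (x y : EuclideanSpace ℝ (Fin d)) :
    |excess z x - excess z y| ≤ dist x y := by
  have key (x y : EuclideanSpace ℝ (Fin d)) : excess z x ≤ excess z y + dist x y :=
    excess_le_add fun j => by
      have := PiLp.norm_apply_le (x - y) j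
      rw [← dist_eq_norm] at this
      exact (le_abs_self _).trans this
  rw [abs_le]
  constructor
  · linarith [key y x, dist_comm x y]
  · linarith [key x y]

theorem continuous_excess : Continuous (excess z) :=
  (LipschitzWith.of_dist_le_mul (K := 1) fun x y => by
    simpa [Real.dist_eq] using abs_excess_sub_le (z := z) x y).continuous

end excess

/-! ### Linear ramps and their expectations. -/

/-- The piecewise linear function equal to one on `(-∞, a]` and to zero on `[b, ∞)`. -/
noncomputable def ramp (a b t : ℝ) : ℝ := max 0 (min 1 ((b - t) / (b - a)))

section ramp

variable {a b : ℝ}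

theorem ramp_mem_Icc (t : ℝ) : ramp a b t ∈ Set.Icc (0 : ℝ) 1 :=
  ⟨le_max_left _ _, max_le zero_le_one (min_le_left _ _)⟩

theorem antitone_ramp (hab : a < b) : Antitone (ramp a b) := fun s t hst => by
  have : 0 < b - a := sub_pos.2 hab
  exact max_le_max le_rfl (min_le_min le_rfl
    (div_le_div_of_nonneg_right (sub_le_sub_left hst b) this.le))

theorem abs_ramp_sub_le (hab : a < b) (s t : ℝ) :
    |ramp a b s - ramp a b t| ≤ (b - a)⁻¹ * |s - t| := by
  have h0 : 0 < b - a := sub_pos.2 hab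
  have h2 := abs_max_sub_max_le_max (0 : ℝ) (min 1 ((b - s) / (b - a))) 0
    (min 1 ((b - t) / (b - a)))
  rw [sub_self (0 : ℝ), abs_zero, max_eq_right (abs_nonneg (min 1 ((b - s) / (b - a)) - min 1 ((b - t) / (b - a))))] at h2
  refine h2.trans ?_
  have h1 := abs_min_sub_min_le_max 1 ((b - s) / (b - a)) 1 ((b - t) / (b - a))
  refine h1.trans (le_of_eq ?_)
  rw [sub_self, abs_zero, max_eq_right (abs_nonneg _), ← sub_div, abs_div, abs_of_pos h0,
    div_eq_inv_mul, abs_sub_comm s t]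
  congr 2
  ring

theorem ramp_eq_one (hab : a < b) {t : ℝ} (ht : t ≤ a) : ramp a b t = 1 := by
  have h0 : 0 < b - a := sub_pos.2 hab
  have : 1 ≤ (b - t) / (b - a) := by rw [le_div_iff₀ h0]; linarith
  simp [ramp, this]

theorem ramp_eq_zero (hab : a < b) {t : ℝ} (ht : b ≤ t) : ramp a b t = 0 := by
  have h0 : 0 < b - a := sub_pos.2 hab
  have : (b - t) / (b - a) ≤ 0 := div_nonpos_of_nonpos_of_nonneg (by linarith) h0.le
  unfold ramp
  rw [max_eq_left]
  exact (min_le_right _ _).trans this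

theorem ramp_sub (a b t s : ℝ) : ramp a b (t - s) = ramp (a + s) (b + s) t := by
  unfold ramp
  congr 3 <;> ring

/-- A layer-cake formula: the ramp is the uniform mixture over t in (a, b] of the indicators of g ≤
t. By Fubini, the expectation of a ramp is then an average of distribution functions. -/
theorem ramp_eq_integral (hab : a < b) (g : ℝ) :
    ramp a b g = (b - a)⁻¹ * ∫ t in Set.Ioc a b, (Set.Ici g).indicator (fun _ => (1 : ℝ)) t := by
  have h0 : 0 < b - a := sub_pos.2 hab
  have h1 : ∫ t in Set.Ioc a b, (Set.Ici g).indicator (fun _ => (1 : ℝ)) t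
      = volume.real (Set.Ici g ∩ Set.Ioc a b) := by
    rw [← measureReal_restrict_apply measurableSet_Ici]
    exact integral_indicator_one measurableSet_Ici
  rw [h1, inv_mul_eq_div, eq_div_iff h0.ne']
  rcases le_or_gt g a with hga | hga
  · have h2 : Set.Ioc a b ⊆ Set.Ici g := fun t ht => hga.trans ht.1.le
    rw [ramp_eq_one hab hga, Set.inter_eq_right.2 h2,
      Real.volume_real_Ioc_of_le hab.le, one_mul]
  rcases le_or_gt b g with hgb | hgb
  · rw [ramp_eq_zero hab hgb, zero_mul]
    have : Set.Ici g ∩ Set.Ioc a b ⊆ {b} := fun t ht => le_antisymm ht.2.2 (hgb.trans ht.1)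
    rw [Measure.real, measure_mono_null this Real.volume_singleton, ENNReal.toReal_zero]
  · have h2 : Set.Ici g ∩ Set.Ioc a b = Set.Icc g b := by
      ext t
      simp only [Set.mem_inter_iff, Set.mem_Ici, Set.mem_Ioc, Set.mem_Icc]
      exact ⟨fun h => ⟨h.1, h.2.2⟩, fun h => ⟨h.1, hga.trans_le h.1, h.2⟩⟩
    rw [h2, Real.volume_real_Icc_of_le hgb.le, ramp, min_eq_right, max_eq_right,
      div_mul_cancel₀ _ h0.ne']
    · exact div_nonneg (by linarith) h0.le
    · rw [div_le_one h0]; linarith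

theorem integral_ramp {E : Type*} [MeasurableSpace E] (ν : Measure E) [IsFiniteMeasure ν]
    {G : E → ℝ} (hG : Measurable G) (hab : a < b) :
    IntegrableOn (fun t => ν.real {x | G x ≤ t}) (Set.Ioc a b) ∧
    ∫ x, ramp a b (G x) ∂ν = (b - a)⁻¹ * ∫ t in Set.Ioc a b, ν.real {x | G x ≤ t} := by
  have hms : MeasurableSet {p : E × ℝ | G p.1 ≤ p.2} :=
    measurableSet_le (hG.comp measurable_fst) measurable_snd
  have hint : Integrable (Function.uncurry fun x t => (Set.Ici (G x)).indicator
      (fun _ => (1 : ℝ)) t) (ν.prod (volume.restrict (Set.Ioc a b))) := by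
    have : (Function.uncurry fun x t => (Set.Ici (G x)).indicator (fun _ => (1 : ℝ)) t)
        = Set.indicator {p : E × ℝ | G p.1 ≤ p.2} fun _ => (1 : ℝ) := by
      ext ⟨x, t⟩
      simp [Set.indicator_apply]
    rw [this]
    exact (integrable_const 1).indicator hms
  have e (t : ℝ) : ∫ x, (Set.Ici (G x)).indicator (fun _ => (1 : ℝ)) t ∂ν
      = ν.real {x | G x ≤ t} := by
    rw [← integral_indicator_one (measurableSet_le hG measurable_const)]
    congr 1
  refine ⟨?_, ?_⟩
  · have := hint.integral_prod_right
    simpa [Function.uncurry, e, IntegrableOn] using this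
  · simp only [ramp_eq_integral hab]
    rw [integral_const_mul, integral_integral_swap hint]
    simp only [e]

theorem integral_Ioc_affine (hab : a < b) (p c : ℝ) :
    (b - a)⁻¹ * ∫ t in Set.Ioc a b, (p + c * t) = p + c * ((a + b) / 2) := by
  have h0 : b - a ≠ 0 := (sub_pos.2 hab).ne'
  rw [← intervalIntegral.integral_of_le hab.le, intervalIntegral.integral_add
    (continuous_const.intervalIntegrable _ _)
    (Continuous.intervalIntegrable (by fun_prop) _ _),
    intervalIntegral.integral_const_mul, integral_id, intervalIntegral.integral_const, smul_eq_mul]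
  field_simp
  ring

/-- An affine bound averages to its value at the midpoint, so a ramp costs only half of its width.
-/
theorem integral_ramp_le {E : Type*} [MeasurableSpace E] (ν : Measure E) [IsFiniteMeasure ν]
    {G : E → ℝ} (hG : Measurable G) (hab : a < b) {p c : ℝ}
    (h : ∀ t ∈ Set.Ioc a b, ν.real {x | G x ≤ t} ≤ p + c * t) :
    ∫ x, ramp a b (G x) ∂ν ≤ p + c * ((a + b) / 2) := by
  obtain ⟨hi, he⟩ := integral_ramp ν hG hab
  rw [he, ← integral_Ioc_affine hab]
  have h0 : 0 < b - a := sub_pos.2 hab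
  exact mul_le_mul_of_nonneg_left
    (setIntegral_mono_on hi (Continuous.integrableOn_Ioc (by fun_prop)) measurableSet_Ioc h)
    (inv_nonneg.2 h0.le)

theorem le_integral_ramp {E : Type*} [MeasurableSpace E] (ν : Measure E) [IsFiniteMeasure ν]
    {G : E → ℝ} (hG : Measurable G) (hab : a < b) {p c : ℝ}
    (h : ∀ t ∈ Set.Ioc a b, p + c * t ≤ ν.real {x | G x ≤ t}) :
    p + c * ((a + b) / 2) ≤ ∫ x, ramp a b (G x) ∂ν := by
  obtain ⟨hi, he⟩ := integral_ramp ν hG hab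
  rw [he, ← integral_Ioc_affine hab]
  have h0 : 0 < b - a := sub_pos.2 hab
  exact mul_le_mul_of_nonneg_left
    (setIntegral_mono_on (Continuous.integrableOn_Ioc (by fun_prop)) hi measurableSet_Ioc h)
    (inv_nonneg.2 h0.le)

end ramp

/-! ### Averaged ramps as test functions. -/

section smoothRamp

variable {d : ℕ} [Nonempty (Fin d)] {z : EuclideanSpace ℝ (Fin d)} {w a b : ℝ}

theorem partialLip_ramp_excess (hab : a < b) :
    PartialLip 0 (fun _ => (b - a)⁻¹) (fun x => ramp a b (excess z x)) := fun x y => by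
  have h0 : 0 < b - a := sub_pos.2 hab
  refine (abs_ramp_sub_le hab _ _).trans ?_
  gcongr
  exact abs_excess_sub_le x y

/-- Each averaging step looks at excesses within `w` of the current one; monotonicity of `φ` turns r
steps into a shift of the argument by at most rw. -/
theorem iterate_boxAvg_mem_Icc (hw : 0 < w) {φ : ℝ → ℝ} (hφ : Antitone φ) {L : ℝ}
    (hL : PartialLip 0 (fun _ => L) (fun x => φ (excess z x))) (r : ℕ)
    (x : EuclideanSpace ℝ (Fin d)) :
    (boxAvg w)^[r] (fun x => φ (excess z x)) x ∈
      Set.Icc (φ (excess z x + r * w)) (φ (excess z x - r * w)) := by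
  induction r generalizing x with
  | zero => simp
  | succ r ih =>
    rw [Function.iterate_succ_apply']
    refine boxAvg_mem_Icc hw (hL.iterate_boxAvg hw r).lipschitzWith.continuous fun u hu => ?_
    have h1 := ih (x + u)
    have h2 := excess_add_mem_Icc (z := z) (x := x) hu
    push_cast
    exact ⟨(hφ (by linarith [h2.2])).trans h1.1, h1.2.trans (hφ (by linarith [h2.1]))⟩

theorem iterate_boxAvg_mem_Icc_zero_one (hw : 0 < w) (hab : a < b) (r : ℕ)
    (x : EuclideanSpace ℝ (Fin d)) :
    (boxAvg w)^[r] (fun x => ramp a b (excess z x)) x ∈ Set.Icc (0 : ℝ) 1 := by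
  have h := iterate_boxAvg_mem_Icc hw (antitone_ramp hab) (partialLip_ramp_excess (z := z) hab) r x
  exact ⟨(ramp_mem_Icc _).1.trans h.1, h.2.trans (ramp_mem_Icc _).2⟩

end smoothRamp

/-- An anti-concentration bound for orthant probabilities with constant `C`. -/
def OrthantLip {d : ℕ} (ν : Measure (EuclideanSpace ℝ (Fin d))) (C : ℝ) : Prop :=
  ∀ (z : EuclideanSpace ℝ (Fin d)) (t : ℝ), 0 ≤ t →
    ν.real (orthant (diagShift z t)) ≤ ν.real (orthant z) + C * t

/-- A ramp of width 2α/m has slope (m/4)(2/α), and each average over a cube of half-width α/(2m)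
costs m(2/α). The order-k bound is therefore (m^(k+1)/4)(2/α)^(k+1), largest in its first factor for
k + 1 = m. -/
theorem smooth_ramp_bound {m : ℕ} (hm : 1 ≤ m) {M α : ℝ} (hM : (m : ℝ) ^ m ≤ 4 * M) (hα : 0 < α)
    {k : ℕ} (hk : k ≤ m - 1) :
    (2 * α / m)⁻¹ / (α / (2 * m)) ^ k ≤ M * max 1 ((2 / α) ^ m) := by
  have hm0 : (1 : ℝ) ≤ m := by exact_mod_cast hm
  have hkm : k + 1 ≤ m := by omega
  have e : (2 * α / m)⁻¹ / (α / (2 * m)) ^ k = (m : ℝ) ^ (k + 1) / 4 * (2 / α) ^ (k + 1) := by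
    have : α / (2 * m) = (m * (2 / α) : ℝ)⁻¹ := by
      field_simp
    rw [this, inv_pow, div_inv_eq_mul, mul_pow, pow_succ, pow_succ]
    field_simp
    norm_num
  rw [e]
  have h1 : (m : ℝ) ^ (k + 1) / 4 ≤ M := by
    have : (m : ℝ) ^ (k + 1) ≤ (m : ℝ) ^ m := pow_le_pow_right₀ hm0 hkm
    linarith
  have h2 : (2 / α) ^ (k + 1) ≤ max 1 ((2 / α) ^ m) := by
    rcases le_total (2 / α) 1 with h | h
    · exact (pow_le_one₀ (by positivity) h).trans (le_max_left _ _)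
    · exact (pow_le_pow_right₀ h hkm).trans (le_max_right _ _)
  have hM0 : 0 ≤ M := le_trans (by positivity) h1
  gcongr

section approx

variable {d m : ℕ} [Nonempty (Fin d)] {M α C : ℝ} {ν : Measure (EuclideanSpace ℝ (Fin d))}
  [IsProbabilityMeasure ν]

/-- The ramp starts at ε = (m-1)w so that after m - 1 averages it is still 1 on the orthant. The
average lies below the ramp moved by another ε, whose midpoint is 2ε + α/m = α; this is why the cost
is exactly Cα. -/
theorem hasUpperApprox_of_pow_le (hm : 1 ≤ m) (hM : (m : ℝ) ^ m ≤ 4 * M) (hα : 0 < α)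
    (hν : OrthantLip ν C) (z : EuclideanSpace ℝ (Fin d)) :
    HasUpperApprox m (M * max 1 ((2 / α) ^ m)) ν z (C * α) := by
  have hm0 : (0 : ℝ) < m := by exact_mod_cast hm
  set w : ℝ := α / (2 * m) with hwdef
  have hw : 0 < w := by positivity
  set ε : ℝ := ((m - 1 : ℕ) : ℝ) * w with hε
  have hε0 : 0 ≤ ε := by positivity
  have hβ : 0 < 2 * α / m := by positivity
  have hab : ε < ε + 2 * α / m := by linarith
  have hp := partialLip_ramp_excess (z := z) hab
  refine ⟨(boxAvg w)^[m - 1] fun x => ramp ε (ε + 2 * α / m) (excess z x), _,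
    hp.iterate_boxAvg hw (m - 1), fun k hk => ?_, iterate_boxAvg_mem_Icc_zero_one hw hab _,
    fun x hx => ?_, ?_⟩
  · rw [add_sub_cancel_left]
    exact smooth_ramp_bound hm hM hα hk
  · refine le_trans (le_of_eq ?_)
      (iterate_boxAvg_mem_Icc hw (antitone_ramp hab) hp (m - 1) x).1
    rw [ramp_eq_one hab]
    linarith [excess_nonpos_iff.2 hx]
  · have hab' : ε + ε < ε + 2 * α / m + ε := by linarith
    have hint {f : EuclideanSpace ℝ (Fin d) → ℝ} (hf : Continuous f)
        (h : ∀ x, f x ∈ Set.Icc (0 : ℝ) 1) : Integrable f ν :=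
      Integrable.of_bound (C := 1) hf.aestronglyMeasurable
        (Filter.Eventually.of_forall fun x => by
          rw [Real.norm_eq_abs, abs_le]
          constructor <;> linarith [(h x).1, (h x).2])
    have h1 : ∫ x, (boxAvg w)^[m - 1] (fun x => ramp ε (ε + 2 * α / m) (excess z x)) x ∂ν
        ≤ ∫ x, ramp (ε + ε) (ε + 2 * α / m + ε) (excess z x) ∂ν := by
      refine integral_mono (hint (hp.iterate_boxAvg hw _).lipschitzWith.continuous
        (iterate_boxAvg_mem_Icc_zero_one hw hab _))
        (hint (partialLip_ramp_excess hab').lipschitzWith.continuous fun x => ramp_mem_Icc _)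
        fun x => ?_
      refine (iterate_boxAvg_mem_Icc hw (antitone_ramp hab) hp (m - 1) x).2.trans (le_of_eq ?_)
      rw [← hε, ramp_sub]
    refine h1.trans ((integral_ramp_le ν continuous_excess.measurable hab' (c := C)
      (p := ν.real (orthant z)) fun t ht => ?_).trans (le_of_eq ?_))
    · simp only [excess_le_iff]
      exact hν z t (by linarith [ht.1])
    · have : ((m - 1 : ℕ) : ℝ) = m - 1 := by simp [Nat.cast_sub hm]
      rw [hε, this, hwdef]
      field_simp
      ring

theorem hasLowerApprox_of_pow_le (hm : 1 ≤ m) (hM : (m : ℝ) ^ m ≤ 4 * M) (hα : 0 < α)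
    (hν : OrthantLip ν C) (z : EuclideanSpace ℝ (Fin d)) :
    HasLowerApprox m (M * max 1 ((2 / α) ^ m)) ν z (C * α) := by
  have hm0 : (0 : ℝ) < m := by exact_mod_cast hm
  set w : ℝ := α / (2 * m) with hwdef
  have hw : 0 < w := by positivity
  set ε : ℝ := ((m - 1 : ℕ) : ℝ) * w with hε
  have hε0 : 0 ≤ ε := by positivity
  have hβ : 0 < 2 * α / m := by positivity
  have hab : -ε - 2 * α / m < -ε := by linarith
  have hp := partialLip_ramp_excess (z := z) hab
  refine ⟨(boxAvg w)^[m - 1] fun x => ramp (-ε - 2 * α / m) (-ε) (excess z x), _,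
    hp.iterate_boxAvg hw (m - 1), fun k hk => ?_, iterate_boxAvg_mem_Icc_zero_one hw hab _,
    fun x hx => ?_, ?_⟩
  · rw [sub_sub_cancel]
    exact smooth_ramp_bound hm hM hα hk
  · refine (iterate_boxAvg_mem_Icc hw (antitone_ramp hab) hp (m - 1) x).2.trans (le_of_eq ?_)
    rw [ramp_eq_zero hab]
    have := not_le.1 fun h => hx (excess_nonpos_iff.1 h)
    linarith
  · have hab' : -ε - 2 * α / m + -ε < -ε + -ε := by linarith
    have hint {f : EuclideanSpace ℝ (Fin d) → ℝ} (hf : Continuous f)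
        (h : ∀ x, f x ∈ Set.Icc (0 : ℝ) 1) : Integrable f ν :=
      Integrable.of_bound (C := 1) hf.aestronglyMeasurable
        (Filter.Eventually.of_forall fun x => by
          rw [Real.norm_eq_abs, abs_le]
          constructor <;> linarith [(h x).1, (h x).2])
    have h1 : ∫ x, ramp (-ε - 2 * α / m + -ε) (-ε + -ε) (excess z x) ∂ν ≤
        ∫ x, (boxAvg w)^[m - 1] (fun x => ramp (-ε - 2 * α / m) (-ε) (excess z x)) x ∂ν := by
      refine integral_mono
        (hint (partialLip_ramp_excess hab').lipschitzWith.continuous fun x => ramp_mem_Icc _)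
        (hint (hp.iterate_boxAvg hw _).lipschitzWith.continuous
          (iterate_boxAvg_mem_Icc_zero_one hw hab _)) fun x => ?_
      refine le_trans (le_of_eq ?_)
        (iterate_boxAvg_mem_Icc hw (antitone_ramp hab) hp (m - 1) x).1
      rw [← hε, ← ramp_sub, sub_neg_eq_add]
    refine le_trans (le_of_eq ?_) ((le_integral_ramp ν continuous_excess.measurable hab' (c := C)
      (p := ν.real (orthant z)) fun t ht => ?_).trans h1)
    · have : ((m - 1 : ℕ) : ℝ) = m - 1 := by simp [Nat.cast_sub hm]
      rw [hε, this, hwdef]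
      field_simp
      ring
    · simp only [excess_le_iff]
      -- Here t ≤ 0, so the anti-concentration bound is applied from the smaller orthant up to the
      -- one at `z`.
      have := hν (diagShift z t) (-t) (by linarith [ht.2])
      have e : diagShift (diagShift z t) (-t) = z := by
        ext j
        simp
      rw [e] at this
      change _ ≤ ν.real (orthant (diagShift z t))
      linarith

end approx

/-! ### Comparison of m^m with the constants. -/

/-- Squaring removes the half-integer power of 2. The induction needs (1 + 1/m)^(2(m+1)) ≤ 8, which
follows from e^(2+2/m) ≤ 8; since log 8 ≈ 2.079 this is only available for large m, and smaller
cases are computed. -/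
theorem pow_self_sq_le (m : ℕ) (hm : 5 ≤ m) : (m ^ m) ^ 2 ≤ 8 ^ m * (m - 1).factorial ^ 2 := by
  rcases le_or_gt m 26 with h | h
  · interval_cases m <;> norm_num [Nat.factorial]
  · induction m, h using Nat.le_induction with
    | base => norm_num [Nat.factorial]
    | succ m hm' ih =>
      have ih := ih (by omega)
      have hm0 : (27 : ℝ) ≤ m := by exact_mod_cast hm'
      have key : ((m : ℝ) + 1) ^ (2 * (m + 1)) ≤ 8 * (m : ℝ) ^ (2 * (m + 1)) := by
        have h1 : (m : ℝ) + 1 ≤ m * Real.exp (1 / m) := by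
          have := Real.add_one_le_exp (1 / (m : ℝ))
          calc (m : ℝ) + 1 = m * (1 / m + 1) := by field_simp; ring
            _ ≤ _ := by gcongr
        have h2 : Real.exp (1 / m) ^ (2 * (m + 1)) ≤ 8 := by
          rw [← Real.exp_nat_mul]
          -- The bound 2 + 2/m ≤ 27/13 holds from m = 26 on, and e^27 ≤ 8^13 is just true.
          have h3 : ((2 * (m + 1) : ℕ) : ℝ) * (1 / m) ≤ 27 / 13 := by
            push_cast
            rw [mul_one_div, div_le_iff₀ (by linarith)]
            linarith
          have h4 : Real.exp (27 / 13) ^ 13 ≤ 8 ^ 13 := by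
            rw [← Real.exp_nat_mul]
            have : ((13 : ℕ) : ℝ) * (27 / 13) = (27 : ℕ) * 1 := by norm_num
            rw [this, Real.exp_nat_mul]
            calc Real.exp 1 ^ 27 ≤ 2.7182818286 ^ 27 := by
                  gcongr; exact Real.exp_one_lt_d9.le
              _ ≤ 8 ^ 13 := by norm_num
          exact (Real.exp_le_exp.2 h3).trans
            ((pow_le_pow_iff_left₀ (Real.exp_pos _).le (by norm_num) (by norm_num)).1 h4)
        calc ((m : ℝ) + 1) ^ (2 * (m + 1)) ≤ (m * Real.exp (1 / m)) ^ (2 * (m + 1)) := by gcongr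
          _ = Real.exp (1 / m) ^ (2 * (m + 1)) * (m : ℝ) ^ (2 * (m + 1)) := by
            rw [mul_pow, mul_comm]
          _ ≤ _ := by gcongr
      have key' : (m + 1) ^ (2 * (m + 1)) ≤ 8 * m ^ (2 * (m + 1)) := by exact_mod_cast key
      obtain ⟨n, rfl⟩ : ∃ n, m = n + 1 := ⟨m - 1, by omega⟩
      simp only [Nat.add_sub_cancel] at ih ⊢
      calc ((n + 1 + 1) ^ (n + 1 + 1)) ^ 2 = (n + 1 + 1) ^ (2 * (n + 1 + 1)) := by
            rw [← pow_mul, mul_comm]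
        _ ≤ 8 * (n + 1) ^ (2 * (n + 1 + 1)) := key'
        _ = 8 * (n + 1) ^ 2 * ((n + 1) ^ (n + 1)) ^ 2 := by
            rw [← pow_mul, mul_assoc, ← pow_add]; ring_nf
        _ ≤ 8 * (n + 1) ^ 2 * (8 ^ (n + 1) * n.factorial ^ 2) := by gcongr
        _ = _ := by rw [Nat.factorial_succ]; ring

/-- The excluded cases fail: 27 > 16 for m = 3 and 256 > 96 for m = 4. -/
theorem pow_self_le_four_mul_constM {m : ℕ} (hm : 1 ≤ m) (h3 : m ≠ 3) (h4 : m ≠ 4) :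
    (m : ℝ) ^ m ≤ 4 * constM m := by
  rcases le_or_gt m 4 with h | h
  · have : m = 1 ∨ m = 2 := by omega
    rcases this with rfl | rfl
    · simp only [constM, h, if_true]
      norm_num [Real.rpow_neg_one]
    · norm_num [constM]
  · have hn : (((m ^ m) ^ 2 : ℕ) : ℝ) ≤ ((8 ^ m * (m - 1).factorial ^ 2 : ℕ) : ℝ) := by
      exact_mod_cast pow_self_sq_le m h
    push_cast at hn
    have h1 : (4 * constM m) ^ 2 = 8 ^ m * ((m - 1).factorial : ℝ) ^ 2 := by
      have h2 : ((2 : ℝ) ^ (3 * (m : ℝ) / 2 - 2)) ^ 2 * 16 = 8 ^ m := by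
        rw [← Real.rpow_natCast, ← Real.rpow_mul (by norm_num)]
        have e : (3 * (m : ℝ) / 2 - 2) * ((2 : ℕ) : ℝ) = (3 * m : ℕ) - (4 : ℕ) := by
          push_cast; ring
        rw [e, Real.rpow_sub (by norm_num), Real.rpow_natCast, Real.rpow_natCast, pow_mul]
        norm_num
      rw [constM, if_neg (by omega), mul_pow, mul_pow, ← h2]
      ring
    have hc : 0 ≤ 4 * constM m := by
      rw [constM, if_neg (by omega)]
      positivity
    exact (pow_le_pow_iff_left₀ (by positivity) hc two_ne_zero).1 (by rw [h1]; exact hn)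

/-! ### Dimension-free gradient bounds for products. -/

section Weights

/-- For independent events of probabilities `p i`, the left side is the probability that at most one
of them fails. -/
theorem sum_one_sub_mul_prod_erase_le {ι : Type*} [DecidableEq ι] (s : Finset ι) {p : ι → ℝ}
    (h0 : ∀ i ∈ s, 0 ≤ p i) (h1 : ∀ i ∈ s, p i ≤ 1) :
    ∑ j ∈ s, (1 - p j) * ∏ i ∈ s.erase j, p i + ∏ i ∈ s, p i ≤ 1 := by
  induction s using Finset.induction_on with
  | empty => simp
  | insert a s ha ih =>
    have ih := ih (fun i hi => h0 i (Finset.mem_insert_of_mem hi))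
      fun i hi => h1 i (Finset.mem_insert_of_mem hi)
    have ha0 := h0 a (Finset.mem_insert_self a s)
    have ha1 := h1 a (Finset.mem_insert_self a s)
    have hs : ∑ j ∈ s, (1 - p j) * ∏ i ∈ (insert a s).erase j, p i
        = p a * ∑ j ∈ s, (1 - p j) * ∏ i ∈ s.erase j, p i := by
      rw [Finset.mul_sum]
      refine Finset.sum_congr rfl fun j hj => ?_
      have hja : a ≠ j := fun h => ha (h ▸ hj)
      rw [Finset.erase_insert_of_ne hja,
        Finset.prod_insert fun h => ha (Finset.mem_of_mem_erase h)]
      ring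
    rw [Finset.sum_insert ha, Finset.erase_insert ha, hs, Finset.prod_insert ha]
    have hp : ∏ i ∈ s, p i ≤ 1 := Finset.prod_le_one
      (fun i hi => h0 i (Finset.mem_insert_of_mem hi))
      fun i hi => h1 i (Finset.mem_insert_of_mem hi)
    have : p a * (∑ j ∈ s, (1 - p j) * ∏ i ∈ s.erase j, p i + ∏ i ∈ s, p i) ≤ p a * 1 := by
      gcongr
    have h2 : (1 - p a) * ∏ i ∈ s, p i ≤ (1 - p a) * 1 :=
      mul_le_mul_of_nonneg_left hp (by linarith)
    linarith

/-- The squared gradient of a product in which the factors indexed by `J` obey crude bounds, and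
every other factor has its derivative controlled by its distance to one. -/
theorem sum_mul_prod_erase_le {ι : Type*} [Fintype ι] [DecidableEq ι] (J : Finset ι)
    {p q a r : ι → ℝ} {c K : ℝ} (hp : ∀ i, 0 ≤ p i) (hr : ∀ i ∈ J, 0 ≤ r i)
    (hpa : ∀ i ∈ J, p i ≤ a i) (hqa : ∀ i ∈ J, q i ≤ r i * a i)
    (hp1 : ∀ i ∉ J, p i ≤ 1) (hqc : ∀ i ∉ J, q i ≤ c * (1 - p i))
    (hK1 : (∑ i ∈ J, r i) * ∏ i ∈ J, a i ≤ K) (hc : 0 ≤ c) (hK2 : c * ∏ i ∈ J, a i ≤ K) :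
    ∑ j, q j * ∏ i ∈ Finset.univ.erase j, p i ≤ K := by
  have ha (i : ι) (hi : i ∈ J) : 0 ≤ a i := (hp i).trans (hpa i hi)
  have hA : 0 ≤ ∏ i ∈ J, a i := Finset.prod_nonneg ha
  have hpA : ∏ i ∈ J, p i ≤ ∏ i ∈ J, a i := Finset.prod_le_prod (fun i _ => hp i) hpa
  have hP0 : 0 ≤ ∏ i ∈ Jᶜ, p i := Finset.prod_nonneg fun i _ => hp i
  have hJ : ∑ j ∈ J, q j * ∏ i ∈ Finset.univ.erase j, p i ≤
      (∑ i ∈ J, r i) * (∏ i ∈ J, a i) * ∏ i ∈ Jᶜ, p i := by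
    rw [mul_assoc, Finset.sum_mul]
    refine Finset.sum_le_sum fun j hj => ?_
    have e : Finset.univ.erase j = (J.erase j) ∪ Jᶜ := by
      ext i
      simp only [Finset.mem_erase, Finset.mem_univ, and_true, Finset.mem_union,
        Finset.mem_compl]
      by_cases h : i = j
      · subst h; simp [hj]
      · by_cases h' : i ∈ J <;> simp [h, h']
    have hdis : Disjoint (J.erase j) Jᶜ := disjoint_compl_right.mono_left (Finset.erase_subset _ _)
    have h1 : ∏ i ∈ J.erase j, p i ≤ ∏ i ∈ J.erase j, a i :=
      Finset.prod_le_prod (fun i _ => hp i) fun i hi => hpa i (Finset.mem_of_mem_erase hi)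
    rw [e, Finset.prod_union hdis, ← Finset.mul_prod_erase J a hj]
    have h2 : 0 ≤ ∏ i ∈ J.erase j, p i := Finset.prod_nonneg fun i _ => hp i
    have h3 := mul_nonneg (hr j hj) (ha j hj)
    calc q j * ((∏ i ∈ J.erase j, p i) * ∏ i ∈ Jᶜ, p i)
        ≤ (r j * a j) * ((∏ i ∈ J.erase j, a i) * ∏ i ∈ Jᶜ, p i) := by
          gcongr
          exact hqa j hj
      _ = _ := by ring
  have hJc : ∑ j ∈ Jᶜ, q j * ∏ i ∈ Finset.univ.erase j, p i ≤
      c * (∏ i ∈ J, a i) * ∑ j ∈ Jᶜ, (1 - p j) * ∏ i ∈ Jᶜ.erase j, p i := by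
    rw [Finset.mul_sum]
    refine Finset.sum_le_sum fun j hj => ?_
    have hj' : j ∉ J := Finset.mem_compl.1 hj
    have e : Finset.univ.erase j = J ∪ Jᶜ.erase j := by
      ext i
      simp only [Finset.mem_erase, Finset.mem_univ, and_true, Finset.mem_union,
        Finset.mem_compl]
      by_cases h : i = j
      · subst h; simp [hj']
      · by_cases h' : i ∈ J <;> simp [h, h']
    have hdis : Disjoint J (Jᶜ.erase j) :=
      disjoint_compl_right.mono_right (Finset.erase_subset _ _)
    rw [e, Finset.prod_union hdis]
    have h2 : 0 ≤ ∏ i ∈ Jᶜ.erase j, p i := Finset.prod_nonneg fun i _ => hp i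
    have h3 : 0 ≤ ∏ i ∈ J, p i := Finset.prod_nonneg fun i _ => hp i
    have h4 := mul_nonneg hc (sub_nonneg.2 (hp1 j hj'))
    calc q j * ((∏ i ∈ J, p i) * ∏ i ∈ Jᶜ.erase j, p i)
        ≤ (c * (1 - p j)) * ((∏ i ∈ J, a i) * ∏ i ∈ Jᶜ.erase j, p i) := by
          gcongr
          exact hqc j hj'
      _ = _ := by ring
  -- The sum over `J` carries the weight ∏ p over the complement and the other sum the weight ∑ (1 -
  -- p_j) ∏ p. Together these weights are at most one, so the total is `K` and not 2K.
  have hsum := sum_one_sub_mul_prod_erase_le Jᶜ (fun i _ => hp i)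
    fun i hi => hp1 i (Finset.mem_compl.1 hi)
  have hP1 : 0 ≤ ∑ j ∈ Jᶜ, (1 - p j) * ∏ i ∈ Jᶜ.erase j, p i := Finset.sum_nonneg fun j hj =>
    mul_nonneg (sub_nonneg.2 (hp1 j (Finset.mem_compl.1 hj))) (Finset.prod_nonneg fun i _ => hp i)
  have hK0 : 0 ≤ K := (mul_nonneg hc hA).trans hK2
  rw [← Finset.sum_add_sum_compl J]
  calc _ ≤ _ := add_le_add hJ hJc
    _ ≤ K * ∏ i ∈ Jᶜ, p i + K * ∑ j ∈ Jᶜ, (1 - p j) * ∏ i ∈ Jᶜ.erase j, p i := by gcongr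
    _ = K * (∑ j ∈ Jᶜ, (1 - p j) * ∏ i ∈ Jᶜ.erase j, p i + ∏ i ∈ Jᶜ, p i) := by ring
    _ ≤ K * 1 := by gcongr
    _ = K := mul_one K

end Weights

/-- If `f ≤ 1` and `f'' ≥ -A`, then `f' ^ 2 ≤ 2 A (1 - f)`. -/
theorem sq_deriv_le_of_le_one {f f' f'' : ℝ → ℝ} {A : ℝ} (hA : 0 < A)
    (hf : ∀ x, HasDerivAt f (f' x) x) (hf' : ∀ x, HasDerivAt f' (f'' x) x) (h1 : ∀ x, f x ≤ 1)
    (h2 : ∀ x, -A ≤ f'' x) (x : ℝ) : f' x ^ 2 ≤ 2 * A * (1 - f x) := by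
  -- The difference of `f` and its tangent parabola of curvature -A at `x` is convex with a double
  -- zero at `x`, hence nonnegative.
  set φ : ℝ → ℝ := fun y => f y - f x - f' x * (y - x) + A / 2 * (y - x) ^ 2 with hφ
  set φ' : ℝ → ℝ := fun y => f' y - f' x + A * (y - x) with hφ'
  have hd (y : ℝ) : HasDerivAt φ (φ' y) y := by
    have h := (((hf y).sub_const (f x)).sub
      (((hasDerivAt_id y).sub_const x).const_mul (f' x))).add
      ((((hasDerivAt_id y).sub_const x).pow 2).const_mul (A / 2))
    refine h.congr_deriv ?_
    simp only [hφ', id]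
    push_cast
    ring
  have hd' (y : ℝ) : HasDerivAt φ' (f'' y + A) y := by
    have h := ((hf' y).sub_const (f' x)).add (((hasDerivAt_id y).sub_const x).const_mul A)
    refine h.congr_deriv ?_
    ring
  have hmono : Monotone φ' := monotone_of_deriv_nonneg (fun y => (hd' y).differentiableAt)
    fun y => by rw [(hd' y).deriv]; linarith [h2 y]
  have hx' : φ' x = 0 := by simp [hφ']
  have hx : φ x = 0 := by simp [hφ]
  have hpos (y : ℝ) : 0 ≤ φ y := by
    rcases lt_trichotomy y x with h | h | h
    · have : AntitoneOn φ (Set.Iic x) := antitoneOn_of_deriv_nonpos (convex_Iic x)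
        (fun y _ => (hd y).continuousAt.continuousWithinAt)
        (fun y _ => (hd y).differentiableAt.differentiableWithinAt) fun y hy => by
          rw [interior_Iic] at hy
          rw [(hd y).deriv, ← hx']
          exact hmono (le_of_lt hy)
      rw [← hx]
      exact this h.le Set.self_mem_Iic h.le
    · rw [h, hx]
    · have : MonotoneOn φ (Set.Ici x) := monotoneOn_of_deriv_nonneg (convex_Ici x)
        (fun y _ => (hd y).continuousAt.continuousWithinAt)
        (fun y _ => (hd y).differentiableAt.differentiableWithinAt) fun y hy => by
          rw [interior_Ici] at hy
          rw [(hd y).deriv, ← hx']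
          exact hmono (le_of_lt hy)
      rw [← hx]
      exact this Set.self_mem_Ici h.le h.le
  -- At the vertex of the parabola its height is f(x) + f'(x)²/(2A), which cannot exceed 1.
  have h3 := hpos (x + f' x / A)
  have h4 := h1 (x + f' x / A)
  simp only [hφ, add_sub_cancel_left] at h3
  have e : A / 2 * (f' x / A) ^ 2 - f' x * (f' x / A) = -(f' x ^ 2 / (2 * A)) := by
    field_simp
    ring
  have h5 : f' x ^ 2 / (2 * A) ≤ 1 - f x := by linarith
  rwa [div_le_iff₀' (by positivity)] at h5

/-- A function `F 0` on the line that decreases from one to zero on `[-1, 1]`, with derivatives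
`F 1, …, F (m - 1)`, the last one being `M`-Lipschitz. The numbers `a k` bound the squares of these
derivatives; their relations ensure that all partial derivatives of order less than `m` of
`∏ j, F 0 (x j)` are `M`-Lipschitz in every dimension. -/
structure SmoothStep (m : ℕ) (M : ℝ) (F : ℕ → ℝ → ℝ) (a : ℕ → ℝ) (c θ κ : ℝ) : Prop where
  two_le : 2 ≤ m
  hasDerivAt : ∀ k, k + 1 < m → ∀ x, HasDerivAt (F k) (F (k + 1) x) x
  right : ∀ x, ∃ r, r ^ 2 ≤ a m ∧ HasDerivWithinAt (F (m - 1)) r (Set.Ici x) x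
  left : ∀ x, ∃ r, r ^ 2 ≤ a m ∧ HasDerivWithinAt (F (m - 1)) r (Set.Iic x) x
  mem_Icc : ∀ x, F 0 x ∈ Set.Icc (0 : ℝ) 1
  eq_one : ∀ x ≤ -1, F 0 x = 1
  eq_zero : ∀ x, 1 ≤ x → F 0 x = 0
  sq_deriv_le : ∀ x, F 1 x ^ 2 ≤ c * (1 - F 0 x ^ 2)
  sq_le : ∀ k, 1 ≤ k → k < m → ∀ x, F k x ^ 2 ≤ a k
  M_nonneg : 0 ≤ M
  c_nonneg : 0 ≤ c
  one_le_θ : 1 ≤ θ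
  κ_nonneg : 0 ≤ κ
  a_le : ∀ k, 1 ≤ k → k + 1 < m → a k ≤ θ ^ k
  a_succ_le : ∀ k, 1 ≤ k → k + 1 < m → a (k + 1) ≤ κ * k * a k
  bound₁ : κ * (m - 1 : ℕ) * θ ^ (m - 1) ≤ M ^ 2
  bound₂ : c * θ ^ (m - 1) ≤ M ^ 2
  bound₃ : c * a (m - 1) ≤ M ^ 2
  bound₄ : a m ≤ M ^ 2
  a_pos : 0 < a (m - 1)

namespace SmoothStep

variable {m : ℕ} {M : ℝ} {F : ℕ → ℝ → ℝ} {a : ℕ → ℝ} {c θ κ : ℝ}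

theorem a_nonneg (h : SmoothStep m M F a c θ κ) {k : ℕ} (hk : 1 ≤ k) (hkm : k ≤ m) : 0 ≤ a k := by
  rcases hkm.lt_or_eq with hlt | rfl
  · exact (sq_nonneg _).trans (h.sq_le k hk hlt 0)
  · obtain ⟨r, hr, -⟩ := h.right 0
    exact (sq_nonneg _).trans hr

/-- If one factor carries all m - 1 derivatives, the others are undifferentiated and `bound₃`,
`bound₄` apply. Otherwise every order is below m - 1, the bounds `a k ≤ θ ^ k` multiply, and
`bound₁`, `bound₂` apply. The split is needed because `a (m - 1)` may exceed the corresponding power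
of θ. -/
theorem sum_mul_prod_le (h : SmoothStep m M F a c θ κ) {d : ℕ} (n : Fin d → ℕ)
    (hn : ∑ j, n j ≤ m - 1) {p q : Fin d → ℝ} (hp : ∀ i, 0 ≤ p i)
    (hpa : ∀ i, n i ≠ 0 → p i ≤ a (n i)) (hqa : ∀ i, n i ≠ 0 → q i ≤ a (n i + 1))
    (hp1 : ∀ i, n i = 0 → p i ≤ 1) (hqc : ∀ i, n i = 0 → q i ≤ c * (1 - p i)) :
    ∑ j, q j * ∏ i ∈ Finset.univ.erase j, p i ≤ M ^ 2 := by
  have hm := h.two_le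
  have hle (i : Fin d) : n i ≤ ∑ j, n j :=
    Finset.single_le_sum (fun j _ => Nat.zero_le (n j)) (Finset.mem_univ i)
  by_cases hex : ∃ j₀, n j₀ = m - 1
  · obtain ⟨j₀, hj₀⟩ := hex
    have h0 (i : Fin d) (hi : i ∉ ({j₀} : Finset (Fin d))) : n i = 0 := by
      rw [Finset.mem_singleton] at hi
      have := Finset.add_sum_erase Finset.univ n (Finset.mem_univ j₀)
      have h1 := Finset.single_le_sum (f := n) (s := Finset.univ.erase j₀)
        (fun j _ => Nat.zero_le (n j)) (Finset.mem_erase.2 ⟨hi, Finset.mem_univ i⟩)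
      omega
    have hne : n j₀ ≠ 0 := by omega
    have hapos : 0 < a (n j₀) := hj₀ ▸ h.a_pos
    have e : n j₀ + 1 = m := by omega
    have ham := h.a_nonneg (k := m) (by omega) le_rfl
    refine sum_mul_prod_erase_le {j₀} (a := fun i => a (n i))
      (r := fun i => a (n i + 1) / a (n i)) hp ?_ ?_ ?_ (fun i hi => hp1 i (h0 i hi))
      (fun i hi => hqc i (h0 i hi)) ?_ h.c_nonneg ?_
    · intro i hi
      rw [Finset.mem_singleton.1 hi, e]
      positivity
    · intro i hi
      rw [Finset.mem_singleton.1 hi]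
      exact hpa j₀ hne
    · intro i hi
      rw [Finset.mem_singleton.1 hi, div_mul_cancel₀ _ hapos.ne']
      exact hqa j₀ hne
    · rw [Finset.sum_singleton, Finset.prod_singleton, div_mul_cancel₀ _ hapos.ne', e]
      exact h.bound₄
    · rw [Finset.prod_singleton, hj₀]
      exact h.bound₃
  · push Not at hex
    have hlt (i : Fin d) : n i + 1 < m := by
      have := hle i
      have := hex i
      omega
    set J : Finset (Fin d) := Finset.univ.filter fun i => n i ≠ 0 with hJ
    have hmem (i : Fin d) : i ∈ J ↔ n i ≠ 0 := by simp [hJ]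
    have h1 (i : Fin d) (hi : i ∈ J) : 1 ≤ n i := Nat.one_le_iff_ne_zero.2 ((hmem i).1 hi)
    have hA0 : 0 ≤ ∏ i ∈ J, a (n i) :=
      Finset.prod_nonneg fun i hi => h.a_nonneg (h1 i hi) (by have := hlt i; omega)
    have hA : ∏ i ∈ J, a (n i) ≤ θ ^ (m - 1) := by
      calc ∏ i ∈ J, a (n i) ≤ ∏ i ∈ J, θ ^ n i := Finset.prod_le_prod
            (fun i hi => h.a_nonneg (h1 i hi) (by have := hlt i; omega))
            fun i hi => h.a_le _ (h1 i hi) (hlt i)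
        _ = θ ^ ∑ i ∈ J, n i := Finset.prod_pow_eq_pow_sum _ _ _
        _ ≤ θ ^ (m - 1) := pow_le_pow_right₀ h.one_le_θ
            ((Finset.sum_le_sum_of_subset (Finset.subset_univ J)).trans hn)
    have hR : ∑ i ∈ J, κ * (n i : ℝ) ≤ κ * (m - 1 : ℕ) := by
      rw [← Finset.mul_sum]
      refine mul_le_mul_of_nonneg_left ?_ h.κ_nonneg
      exact_mod_cast (Finset.sum_le_sum_of_subset (Finset.subset_univ J)).trans hn
    have hκ := h.κ_nonneg
    have hc := h.c_nonneg
    have hθ := h.one_le_θ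
    refine sum_mul_prod_erase_le J (a := fun i => a (n i)) (r := fun i => κ * n i) hp
      (fun i _ => by positivity) (fun i hi => hpa i ((hmem i).1 hi))
      (fun i hi => (hqa i ((hmem i).1 hi)).trans (h.a_succ_le _ (h1 i hi) (hlt i)))
      (fun i hi => hp1 i (by simpa [hmem] using hi)) (fun i hi => hqc i (by simpa [hmem] using hi))
      ?_ h.c_nonneg ?_
    · refine le_trans ?_ h.bound₁
      gcongr
    · refine le_trans ?_ h.bound₂
      gcongr

/-- The derivative of top order has only one-sided derivatives. Moving forward along a line of slope
`v` approaches a knot from a side determined by the sign of `v`, which selects the one to use. -/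
theorem exists_right_deriv (h : SmoothStep m M F a c θ κ) {k : ℕ} (hk : k < m) (x v : ℝ) :
    ∃ r, (k ≠ 0 → r ^ 2 ≤ a (k + 1)) ∧ (k = 0 → r ^ 2 ≤ c * (1 - F k x ^ 2)) ∧
      ∀ y t, y + t * v = x →
        HasDerivWithinAt (fun s => F k (y + s * v)) (r * v) (Set.Ici t) t := by
  have hm := h.two_le
  have hline (y t : ℝ) : HasDerivAt (fun s => y + s * v) v t := by
    simpa using ((hasDerivAt_id t).mul_const v).const_add y
  rcases Nat.lt_or_ge (k + 1) m with hlt | hge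
  · refine ⟨F (k + 1) x, fun _ => h.sq_le _ (by omega) hlt x, ?_, ?_⟩
    · rintro rfl
      exact h.sq_deriv_le x
    · rintro y t rfl
      exact ((h.hasDerivAt k hlt _).comp t (hline y t)).hasDerivWithinAt
  · obtain rfl : k = m - 1 := by omega
    have e : m - 1 + 1 = m := by omega
    rcases le_total 0 v with hv | hv
    · obtain ⟨r, hr, hd⟩ := h.right x
      refine ⟨r, fun _ => by rwa [e], fun h0 => by omega, ?_⟩
      rintro y t rfl
      refine hd.comp t (hline y t).hasDerivWithinAt fun s hs => ?_
      have : t * v ≤ s * v := mul_le_mul_of_nonneg_right hs hv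
      exact add_le_add_right this y
    · obtain ⟨r, hr, hd⟩ := h.left x
      refine ⟨r, fun _ => by rwa [e], fun h0 => by omega, ?_⟩
      rintro y t rfl
      refine hd.comp t (hline y t).hasDerivWithinAt fun s hs => ?_
      have : s * v ≤ t * v := mul_le_mul_of_nonpos_right hs hv
      exact add_le_add_right this y

/-- The mixed derivative `∏ j, F (n j) (x j)` of the product function. -/
def prodDeriv (F : ℕ → ℝ → ℝ) {d : ℕ} (n : Fin d → ℕ) (x : EuclideanSpace ℝ (Fin d)) : ℝ :=
  ∏ j, F (n j) (x j)

theorem continuous_F (h : SmoothStep m M F a c θ κ) {k : ℕ} (hk : k < m) : Continuous (F k) := by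
  rcases Nat.lt_or_ge (k + 1) m with hlt | hge
  · exact continuous_iff_continuousAt.2 fun x => (h.hasDerivAt k hlt x).continuousAt
  · obtain rfl : k = m - 1 := by omega
    refine continuous_iff_continuousAt.2 fun x => continuousAt_iff_continuous_left_right.2 ?_
    obtain ⟨r, -, hr⟩ := h.right x
    obtain ⟨l, -, hl⟩ := h.left x
    exact ⟨hl.continuousWithinAt, hr.continuousWithinAt⟩

/-- The mean value inequality with right derivatives is applied along the segment from `y` to `x`.
By Cauchy–Schwarz the slope is at most the Euclidean norm of the gradient times the distance, and
`sum_mul_prod_le` bounds that norm. -/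
theorem abs_prodDeriv_sub_le (h : SmoothStep m M F a c θ κ) {d : ℕ} (n : Fin d → ℕ)
    (hn : ∑ j, n j ≤ m - 1) (x y : EuclideanSpace ℝ (Fin d)) :
    |prodDeriv F n x - prodDeriv F n y| ≤ M * dist x y := by
  have hm := h.two_le
  have hlt (i : Fin d) : n i < m := by
    have := Finset.single_le_sum (fun j _ => Nat.zero_le (n j)) (Finset.mem_univ i)
    omega
  set v : Fin d → ℝ := fun j => x j - y j with hv
  set φ : ℝ → ℝ := fun t => ∏ j, F (n j) (y j + t * v j) with hφ
  choose r hr1 hr2 hr3 using fun (j : Fin d) (x : ℝ) => h.exists_right_deriv (hlt j) x (v j)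
  have hcont : Continuous φ := continuous_finsetProd _ fun j _ =>
    (h.continuous_F (hlt j)).comp (by fun_prop)
  have hder (t : ℝ) : HasDerivWithinAt φ
      (∑ j, (∏ i ∈ Finset.univ.erase j, F (n i) (y i + t * v i)) • (r j (y j + t * v j) * v j))
      (Set.Ici t) t :=
    HasDerivWithinAt.fun_finsetProd fun j _ => hr3 j _ (y j) t rfl
  have hbound (t : ℝ) : ‖∑ j, (∏ i ∈ Finset.univ.erase j, F (n i) (y i + t * v i)) •
      (r j (y j + t * v j) * v j)‖ ≤ M * dist x y := by
    have hsq : ∑ j, (r j (y j + t * v j) *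
        ∏ i ∈ Finset.univ.erase j, F (n i) (y i + t * v i)) ^ 2 ≤ M ^ 2 := by
      have := h.sum_mul_prod_le n hn (p := fun i => F (n i) (y i + t * v i) ^ 2)
        (q := fun i => r i (y i + t * v i) ^ 2) (fun i => sq_nonneg _)
        (fun i hi => h.sq_le _ (Nat.one_le_iff_ne_zero.2 hi) (hlt i) _) (fun i hi => hr1 i _ hi)
        (fun i hi => by
          have := h.mem_Icc (y i + t * v i)
          rw [hi]
          exact pow_le_one₀ this.1 this.2)
        (fun i hi => hr2 i _ hi)
      refine le_trans (le_of_eq (Finset.sum_congr rfl fun j _ => ?_)) this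
      rw [mul_pow, Finset.prod_pow]
    have hdist : ∑ j, v j ^ 2 = dist x y ^ 2 := by
      rw [EuclideanSpace.dist_eq, Real.sq_sqrt (by positivity)]
      simp [hv, Real.dist_eq, sq_abs]
    have hCS := Finset.sum_mul_sq_le_sq_mul_sq Finset.univ
      (fun j => r j (y j + t * v j) * ∏ i ∈ Finset.univ.erase j, F (n i) (y i + t * v i)) v
    rw [hdist] at hCS
    rw [Real.norm_eq_abs]
    refine abs_le_of_sq_le_sq ?_ (mul_nonneg h.M_nonneg dist_nonneg)
    calc _ = (∑ j, (r j (y j + t * v j) *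
          ∏ i ∈ Finset.univ.erase j, F (n i) (y i + t * v i)) * v j) ^ 2 := by
            congr 1
            exact Finset.sum_congr rfl fun j _ => by rw [smul_eq_mul]; ring
      _ ≤ M ^ 2 * dist x y ^ 2 := hCS.trans (by gcongr)
      _ = _ := by ring
  have := norm_image_sub_le_of_norm_deriv_right_le_segment (a := 0) (b := 1) hcont.continuousOn
    (fun t _ => hder t) (fun t _ => hbound t) 1 (Set.right_mem_Icc.2 zero_le_one)
  simpa [hφ, hv, prodDeriv] using this

theorem hasFDerivAt_prodDeriv (h : SmoothStep m M F a c θ κ) {d : ℕ} (n : Fin d → ℕ)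
    (hn : ∀ j, n j + 1 < m) (x : EuclideanSpace ℝ (Fin d)) :
    HasFDerivAt (prodDeriv F n)
      (coordForm fun j => prodDeriv F (Function.update n j (n j + 1)) x) x := by
  have hj (j : Fin d) : HasFDerivAt (fun x : EuclideanSpace ℝ (Fin d) => F (n j) (x j))
      (F (n j + 1) (x j) • (EuclideanSpace.proj j : EuclideanSpace ℝ (Fin d) →L[ℝ] ℝ)) x :=
    (h.hasDerivAt (n j) (hn j) (x j)).comp_hasFDerivAt x
      (EuclideanSpace.proj j : EuclideanSpace ℝ (Fin d) →L[ℝ] ℝ).hasFDerivAt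
  have := HasFDerivAt.finsetProd (u := Finset.univ) fun j _ => hj j
  refine this.congr_fderiv ?_
  ext1 w
  rw [coordForm_apply]
  simp only [sum_apply, smul_apply, smul_eq_mul]
  refine Finset.sum_congr rfl fun j _ => ?_
  have e : ∏ i ∈ Finset.univ.erase j, F (Function.update n j (n j + 1) i) (x i)
      = ∏ i ∈ Finset.univ.erase j, F (n i) (x i) := Finset.prod_congr rfl fun i hi => by
    rw [Function.update_of_ne (Finset.ne_of_mem_erase hi)]
  rw [prodDeriv, ← Finset.mul_prod_erase Finset.univ _ (Finset.mem_univ j), Function.update_self, e]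
  simp only [PiLp.proj_apply]
  ring

theorem partialLip_prodDeriv (h : SmoothStep m M F a c θ κ) {d : ℕ} (k : ℕ) (n : Fin d → ℕ)
    (hn : ∑ j, n j + k = m - 1) : PartialLip k (fun _ => M) (prodDeriv F n) := by
  have hm := h.two_le
  induction k generalizing n with
  | zero => exact fun x y => h.abs_prodDeriv_sub_le n (by omega) x y
  | succ k ih =>
    refine ⟨fun x y => h.abs_prodDeriv_sub_le n (by omega) x y, _,
      h.hasFDerivAt_prodDeriv n fun j => ?_, fun j => ih _ ?_⟩
    · have := Finset.single_le_sum (fun j _ => Nat.zero_le (n j)) (Finset.mem_univ j)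
      omega
    · have e : ∑ i ∈ Finset.univ.erase j, Function.update n j (n j + 1) i
          = ∑ i ∈ Finset.univ.erase j, n i := Finset.sum_congr rfl fun i hi => by
        rw [Function.update_of_ne (Finset.ne_of_mem_erase hi)]
      rw [← Finset.add_sum_erase Finset.univ _ (Finset.mem_univ j), Function.update_self, e]
      have := Finset.add_sum_erase Finset.univ n (Finset.mem_univ j)
      omega

section approx

variable {d : ℕ} {α C : ℝ} {ν : Measure (EuclideanSpace ℝ (Fin d))} [IsProbabilityMeasure ν]

/-- Scaling by 2/α shrinks the transition interval [-1, 1] to length α. -/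
theorem partialLip_scaled (h : SmoothStep m M F a c θ κ) (hα : 0 < α)
    (z : EuclideanSpace ℝ (Fin d)) :
    ∃ B : ℕ → ℝ, PartialLip (m - 1) B (fun x => prodDeriv F 0 ((2 / α) • (x - z))) ∧
      ∀ k ≤ m - 1, B k ≤ M * max 1 ((2 / α) ^ m) := by
  have hm := h.two_le
  have h1 := (h.partialLip_prodDeriv (d := d) (m - 1) 0 (by simp)).affine 1 0
    (t := 2 / α) (by positivity) z
  refine ⟨_, by simpa only [one_mul, add_zero] using h1, fun k hk => ?_⟩
  have hkm : k + 1 ≤ m := by omega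
  have h2 : (2 / α) ^ (k + 1) ≤ max 1 ((2 / α) ^ m) := by
    rcases le_total (2 / α) 1 with h | h
    · exact (pow_le_one₀ (by positivity) h).trans (le_max_left _ _)
    · exact (pow_le_pow_right₀ h hkm).trans (le_max_right _ _)
  have := h.M_nonneg
  rw [abs_one, one_mul, mul_comm]
  gcongr

theorem prodDeriv_zero_mem_Icc (h : SmoothStep m M F a c θ κ) (x : EuclideanSpace ℝ (Fin d)) :
    prodDeriv F 0 x ∈ Set.Icc (0 : ℝ) 1 :=
  ⟨Finset.prod_nonneg fun j _ => (h.mem_Icc (x j)).1,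
    Finset.prod_le_one (fun j _ => (h.mem_Icc (x j)).1) fun j _ => (h.mem_Icc (x j)).2⟩

theorem prodDeriv_scaled_eq_one (h : SmoothStep m M F a c θ κ) (hα : 0 < α)
    {z x : EuclideanSpace ℝ (Fin d)} (hx : x ∈ orthant z) (b : ℝ) (hb : b = α / 2) :
    prodDeriv F 0 ((2 / α) • (x - diagShift z b)) = 1 := by
  refine Finset.prod_eq_one fun j _ => h.eq_one _ ?_
  have h1 : x j ≤ z j := hx j
  have h2 : (2 / α) * (x j - (z j + b)) ≤ (2 / α) * (-(α / 2)) := by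
    gcongr
    linarith
  have h3 : (2 / α) * (-(α / 2)) = -1 := by field_simp
  rw [h3] at h2
  simpa using h2

theorem prodDeriv_scaled_eq_zero (h : SmoothStep m M F a c θ κ) (hα : 0 < α)
    {z x : EuclideanSpace ℝ (Fin d)} (hx : x ∉ orthant z) (b : ℝ) (hb : b = -(α / 2)) :
    prodDeriv F 0 ((2 / α) • (x - diagShift z b)) = 0 := by
  simp only [orthant, Set.mem_ofPred_eq, not_forall, not_le] at hx
  obtain ⟨j, hj⟩ := hx
  refine Finset.prod_eq_zero (Finset.mem_univ j) (h.eq_zero _ ?_)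
  have h2 : (2 / α) * (α / 2) ≤ (2 / α) * (x j - (z j + b)) := by
    gcongr
    linarith
  have h3 : (2 / α) * (α / 2) = 1 := by field_simp
  rw [h3] at h2
  simpa using h2

theorem diagShift_diagShift (z : EuclideanSpace ℝ (Fin d)) (s t : ℝ) :
    diagShift (diagShift z s) t = diagShift z (s + t) := by
  ext j
  simp [add_assoc]

/-- Centred at z + α/2, the product equals 1 on the orthant at `z` and vanishes off the orthant at z
+ α. The cost is one application of anti-concentration with shift α. -/
theorem hasUpperApprox (h : SmoothStep m M F a c θ κ) (hα : 0 < α) (hν : OrthantLip ν C)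
    (z : EuclideanSpace ℝ (Fin d)) :
    HasUpperApprox m (M * max 1 ((2 / α) ^ m)) ν z (C * α) := by
  obtain ⟨B, hB, hBK⟩ := h.partialLip_scaled hα (diagShift z (α / 2))
  refine ⟨_, B, hB, hBK, fun x => h.prodDeriv_zero_mem_Icc _,
    fun x hx => (h.prodDeriv_scaled_eq_one hα hx _ rfl).ge, le_trans ?_ (hν z α hα.le)⟩
  rw [← integral_indicator_one (measurableSet_orthant _)]
  refine integral_mono_of_nonneg
    (Filter.Eventually.of_forall fun x => (h.prodDeriv_zero_mem_Icc _).1)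
    ((integrable_const 1).indicator (measurableSet_orthant _))
    (Filter.Eventually.of_forall fun x => ?_)
  by_cases hx : x ∈ orthant (diagShift z α)
  · simpa [hx] using (h.prodDeriv_zero_mem_Icc _).2
  · have := h.prodDeriv_scaled_eq_zero hα hx _ rfl
    rw [diagShift_diagShift, show α + -(α / 2) = α / 2 by ring] at this
    simp [hx, this]

theorem hasLowerApprox (h : SmoothStep m M F a c θ κ) (hα : 0 < α) (hν : OrthantLip ν C)
    (z : EuclideanSpace ℝ (Fin d)) :
    HasLowerApprox m (M * max 1 ((2 / α) ^ m)) ν z (C * α) := by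
  obtain ⟨B, hB, hBK⟩ := h.partialLip_scaled hα (diagShift z (-(α / 2)))
  refine ⟨_, B, hB, hBK, fun x => h.prodDeriv_zero_mem_Icc _,
    fun x hx => (h.prodDeriv_scaled_eq_zero hα hx _ rfl).le, ?_⟩
  have h1 := hν (diagShift z (-α)) α hα.le
  have e : diagShift (diagShift z (-α)) α = z := by
    ext j
    simp
  rw [e] at h1
  refine le_trans (sub_le_iff_le_add.2 h1) ?_
  rw [← integral_indicator_one (measurableSet_orthant _)]
  refine integral_mono_of_nonneg
    (Filter.Eventually.of_forall fun x => Set.indicator_nonneg (fun _ _ => zero_le_one) x) ?_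
    (Filter.Eventually.of_forall fun x => ?_)
  · refine Integrable.of_bound (C := 1) hB.lipschitzWith.continuous.aestronglyMeasurable
      (Filter.Eventually.of_forall fun x => ?_)
    have := h.prodDeriv_zero_mem_Icc ((2 / α) • (x - diagShift z (-(α / 2))))
    rw [Real.norm_eq_abs, abs_le]
    constructor <;> linarith [this.1, this.2]
  by_cases hx : x ∈ orthant (diagShift z (-α))
  · have := h.prodDeriv_scaled_eq_one hα hx _ rfl
    rw [diagShift_diagShift, show -α + α / 2 = -(α / 2) by ring] at this
    simp [hx, this]
  · simpa [hx] using (h.prodDeriv_zero_mem_Icc _).1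

end approx

end SmoothStep

/-! ### One-dimensional Gaussian estimates. -/

section OneDimensional

theorem hasDerivAt_gaussianPDFReal_std (x : ℝ) :
    HasDerivAt (gaussianPDFReal 0 1) (-x * gaussianPDFReal 0 1 x) x := by
  simp only [gaussianPDFReal_def, NNReal.coe_one, mul_one, sub_zero]
  have h1 : HasDerivAt (fun x : ℝ => -x ^ 2 / 2) (-x) x := by
    have := ((hasDerivAt_pow 2 x).neg).div_const 2
    refine this.congr_deriv ?_
    push_cast
    ring
  refine ((h1.exp).const_mul (√(2 * Real.pi))⁻¹).congr_deriv ?_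
  ring

theorem gaussianPDFReal_std_le {x y : ℝ} (h : |x| ≤ |y|) :
    gaussianPDFReal 0 1 y ≤ gaussianPDFReal 0 1 x := by
  simp only [gaussianPDFReal_def, NNReal.coe_one, mul_one, sub_zero]
  gcongr 3
  exact neg_le_neg (sq_le_sq.2 h)

theorem gaussianReal_std_real_eq_integral (s : Set ℝ) :
    (gaussianReal 0 1).real s = ∫ x in s, gaussianPDFReal 0 1 x := by
  rw [Measure.real, gaussianReal_apply_eq_integral 0 one_ne_zero,
    ENNReal.toReal_ofReal (integral_nonneg fun x => gaussianPDFReal_nonneg 0 1 x)]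

theorem tendsto_gaussianPDFReal_std_atTop :
    Filter.Tendsto (gaussianPDFReal 0 1) Filter.atTop (nhds 0) := by
  simp only [gaussianPDFReal_def, NNReal.coe_one, mul_one, sub_zero]
  rw [← mul_zero (√(2 * Real.pi))⁻¹]
  refine Filter.Tendsto.const_mul _ (Real.tendsto_exp_atBot.comp ?_)
  refine Filter.Tendsto.atBot_div_const two_pos (Filter.tendsto_neg_atTop_atBot.comp ?_)
  exact Filter.tendsto_pow_atTop two_ne_zero

/-- A bound on the Gaussian hazard rate. -/
theorem gaussianPDFReal_std_le_mul_tail (t : ℝ) :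
    gaussianPDFReal 0 1 t ≤ (max t 0 + 1) * (gaussianReal 0 1).real (Set.Ioi t) := by
  have key (t : ℝ) (ht : 0 ≤ t) :
      gaussianPDFReal 0 1 t ≤ (t + 1) * (gaussianReal 0 1).real (Set.Ioi t) := by
    -- The derivative of this function is at most the density on x > 0, so integrating from t to
    -- infinity bounds density(t)/(t + 1) by the tail.
    set g : ℝ → ℝ := fun x => -(gaussianPDFReal 0 1 x / (x + 1)) with hg
    set g' : ℝ → ℝ := fun x => gaussianPDFReal 0 1 x * ((x ^ 2 + x + 1) / (x + 1) ^ 2) with hg'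
    have hderiv : ∀ x ∈ Set.Ici t, HasDerivAt g (g' x) x := by
      intro x hx
      have hx0 : 0 < x + 1 := by have : t ≤ x := hx; linarith
      have := ((hasDerivAt_gaussianPDFReal_std x).div ((hasDerivAt_id x).add_const 1) hx0.ne').neg
      refine this.congr_deriv ?_
      simp only [hg', id]
      field_simp
      ring
    have hpos : ∀ x ∈ Set.Ioi t, 0 ≤ g' x := by
      intro x hx
      have hx0 : 0 < x := ht.trans_lt hx
      have := gaussianPDFReal_nonneg 0 1 x
      positivity
    have hlim : Filter.Tendsto g Filter.atTop (nhds 0) := by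
      have h1 := tendsto_gaussianPDFReal_std_atTop.mul
        (tendsto_inv_atTop_zero.comp (Filter.tendsto_atTop_add_const_right Filter.atTop (1 : ℝ)
          Filter.tendsto_id))
      rw [mul_zero] at h1
      simpa [hg, div_eq_mul_inv] using h1.neg
    have hint := integrableOn_Ioi_deriv_of_nonneg' hderiv hpos hlim
    have heq := integral_Ioi_of_hasDerivAt_of_nonneg' hderiv hpos hlim
    have hle : ∫ x in Set.Ioi t, g' x ≤ ∫ x in Set.Ioi t, gaussianPDFReal 0 1 x := by
      refine setIntegral_mono_on hint (integrable_gaussianPDFReal 0 1).integrableOn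
        measurableSet_Ioi fun x hx => ?_
      have hx0 : 0 < x := ht.trans_lt hx
      refine mul_le_of_le_one_right (gaussianPDFReal_nonneg 0 1 x) ?_
      rw [div_le_one (by positivity)]
      nlinarith
    rw [heq, ← gaussianReal_std_real_eq_integral] at hle
    simp only [hg, sub_neg_eq_add, zero_add] at hle
    rwa [div_le_iff₀' (by linarith)] at hle
  rcases le_total 0 t with h | h
  · rw [max_eq_left h]
    exact key t h
  · rw [max_eq_right h, zero_add, one_mul]
    calc gaussianPDFReal 0 1 t ≤ gaussianPDFReal 0 1 0 := gaussianPDFReal_std_le (by simp)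
      _ ≤ (gaussianReal 0 1).real (Set.Ioi 0) := by simpa using key 0 le_rfl
      _ ≤ _ := measureReal_mono (Set.Ioi_subset_Ioi h)

theorem gaussianReal_std_real_le_of_pdf_le {s : Set ℝ} {z α K : ℝ} (hα : 0 ≤ α) (hK : 0 ≤ K)
    (hs : s ⊆ Set.Ioc z (z + α)) (h : ∀ x ∈ s, gaussianPDFReal 0 1 x ≤ K) :
    (gaussianReal 0 1).real s ≤ K * α := by
  rw [gaussianReal_std_real_eq_integral]
  have hfin : volume s < ⊤ := (measure_mono hs).trans_lt measure_Ioc_lt_top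
  have h1 := norm_setIntegral_le_of_norm_le_const (f := gaussianPDFReal 0 1) (C := K) hfin
    fun x hx => by
      rw [Real.norm_of_nonneg (gaussianPDFReal_nonneg 0 1 x)]
      exact h x hx
  refine (Real.le_norm_self _).trans (h1.trans ?_)
  gcongr
  refine (measureReal_mono hs measure_Ioc_lt_top.ne).trans (le_of_eq ?_)
  rw [Real.volume_real_Ioc_of_le (by linarith)]
  ring

/-- If x lies in `V` and the window, everything above x belongs to `V ∩ Ioi z`, so the hazard bound
at x compares the density with that mass. The hazard is at most s + 1/2 + 1, because the window has
length at most 1/2. -/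
theorem gaussianReal_std_upper_inter_Ioc_le {V : Set ℝ} (hV : IsUpperSet V) {z s α : ℝ}
    (hs : 0 ≤ s) (hz : z ≤ s) (hα : 0 ≤ α) (hα' : α ≤ 1 / 2) :
    gaussianReal 0 1 (V ∩ Set.Ioc z (z + α)) ≤
      ENNReal.ofReal ((s + 3 / 2) * α) * gaussianReal 0 1 (V ∩ Set.Ioi z) := by
  have h : (gaussianReal 0 1).real (V ∩ Set.Ioc z (z + α)) ≤
      ((s + 3 / 2) * (gaussianReal 0 1).real (V ∩ Set.Ioi z)) * α := by
    refine gaussianReal_std_real_le_of_pdf_le hα (by positivity) Set.inter_subset_right ?_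
    rintro x ⟨hxV, hx⟩
    refine (gaussianPDFReal_std_le_mul_tail x).trans ?_
    have h1 : max x 0 + 1 ≤ s + 3 / 2 := by
      have : max x 0 ≤ s + 1 / 2 := max_le (by linarith [hx.2]) (by linarith)
      linarith
    have h2 : (gaussianReal 0 1).real (Set.Ioi x) ≤ (gaussianReal 0 1).real (V ∩ Set.Ioi z) :=
      measureReal_mono fun y hy => ⟨hV (le_of_lt hy) hxV, hx.1.trans hy⟩
    gcongr
  rw [← ofReal_measureReal (μ := gaussianReal 0 1) (s := V ∩ Set.Ioc z (z + α)),
    ← ofReal_measureReal (μ := gaussianReal 0 1) (s := V ∩ Set.Ioi z),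
    ← ENNReal.ofReal_mul (by positivity)]
  refine ENNReal.ofReal_le_ofReal (h.trans (le_of_eq (by ring)))

/-- Beyond √(2 log d) the hazard bound is too weak, but the density is so small that all d
coordinates together contribute at most α/2. -/
theorem gaussianPDFReal_std_sqrt_two_log_le {d : ℕ} (hd : 0 < d) :
    gaussianPDFReal 0 1 (√(2 * Real.log d)) ≤ (2 * (d : ℝ))⁻¹ := by
  have hd1 : (1 : ℝ) ≤ d := by exact_mod_cast hd
  have hlog : 0 ≤ 2 * Real.log d := by have := Real.log_nonneg hd1; linarith
  simp only [gaussianPDFReal_def, NNReal.coe_one, mul_one, sub_zero]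
  rw [Real.sq_sqrt hlog]
  have e : -(2 * Real.log d) / 2 = -Real.log d := by ring
  rw [e, Real.exp_neg, Real.exp_log (by linarith), mul_inv]
  gcongr
  refine Real.le_sqrt_of_sq_le ?_
  linarith [Real.pi_gt_three]

end OneDimensional

/-! ### Nazarov's inequality. -/

section Window

variable {Ω : Type*} {d : ℕ} {W : Fin d → Ω → ℝ}

/-- The event that `j` is the first index at which `W - z` is maximal. -/
def firstArgmax (W : Fin d → Ω → ℝ) (z : Fin d → ℝ) (j : Fin d) : Set Ω :=
  {ω | ∀ i, W i ω - z i ≤ W j ω - z j ∧ (i < j → W i ω - z i < W j ω - z j)}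

theorem pairwise_disjoint_firstArgmax (z : Fin d → ℝ) :
    Pairwise (Function.onFun Disjoint (firstArgmax W z)) := by
  intro i j hij
  refine Set.disjoint_left.2 fun ω hi hj => ?_
  rcases lt_or_gt_of_ne hij with h | h
  · exact absurd ((hj i).2 h) (not_lt.2 (hi j).1)
  · exact absurd ((hi j).2 h) (not_lt.2 (hj i).1)

theorem exists_mem_firstArgmax [Nonempty (Fin d)] (z : Fin d → ℝ) (ω : Ω) :
    ∃ j, ω ∈ firstArgmax W z j := by
  obtain ⟨j₀, hj₀⟩ := Finite.exists_max fun i => W i ω - z i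
  have hne : {j : Fin d | ∀ i, W i ω - z i ≤ W j ω - z j}.Nonempty := ⟨j₀, hj₀⟩
  obtain ⟨j, hj, hmin⟩ := Set.exists_min_image _ id (Set.toFinite _) hne
  refine ⟨j, fun i => ⟨hj i, fun hij => lt_of_le_of_ne (hj i) fun heq => ?_⟩⟩
  exact absurd hij (not_lt.2 (hmin i fun l => heq ▸ hj l))

variable [MeasurableSpace Ω] {P : Measure Ω} [IsProbabilityMeasure P]

theorem measurableSet_firstArgmax (hm : ∀ i, Measurable (W i)) (z : Fin d → ℝ) (j : Fin d) :
    MeasurableSet (firstArgmax W z j) := by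
  have hmz (i : Fin d) : Measurable fun ω => W i ω - z i := (hm i).sub_const _
  exact measurableSet_setOfPred.2 <| Measurable.forall fun i =>
    (measurableSet_setOfPred.1 (measurableSet_le (hmz i) (hmz j))).and
      (measurable_const.imp (measurableSet_setOfPred.1 (measurableSet_lt (hmz i) (hmz j))))

/-- Regressing every coordinate on `W j` leaves a residual vector independent of `W j`. With the
residuals frozen, being the first maximiser is an upper set in the value of `W j`, since all
regression coefficients are at most 1. The one-dimensional estimate is then integrated over the
residuals. -/
theorem measure_firstArgmax_inter_Ioc_le (hm : ∀ i, Measurable (W i))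
    (hG : HasGaussianLaw (fun ω i => W i ω) P) (hlaw : ∀ i, P.map (W i) = gaussianReal 0 1)
    (z : Fin d → ℝ) (j : Fin d) {s α : ℝ} (hs : 0 ≤ s) (hz : z j ≤ s) (hα : 0 ≤ α)
    (hα' : α ≤ 1 / 2) :
    P (firstArgmax W z j ∩ W j ⁻¹' Set.Ioc (z j) (z j + α)) ≤
      ENNReal.ofReal ((s + 3 / 2) * α) * P (firstArgmax W z j ∩ W j ⁻¹' Set.Ioi (z j)) := by
  have hL2 (i : Fin d) : MemLp (W i) 2 P := (hG.eval i).memLp_two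
  have hvar (i : Fin d) : Var[W i; P] = 1 := by
    have h1 := variance_map (X := id) (Y := W i) (μ := P) aemeasurable_id (hm i).aemeasurable
    rw [hlaw i, variance_id_gaussianReal] at h1
    simpa using h1.symm
  set ρ : Fin d → ℝ := fun i => cov[W j, W i; P] with hρ
  have hρ1 (i : Fin d) : ρ i ≤ 1 := by
    -- The variance of W_j - W_i equals 2 - 2ρ_i and is nonnegative.
    have h1 := variance_sub (hL2 j) (hL2 i)
    have h2 := variance_nonneg (W j - W i) P
    rw [hvar, hvar] at h1
    simp only [hρ]
    linarith
  set R : Ω → Fin d → ℝ := fun ω i => W i ω - ρ i * W j ω with hR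
  have hRm : Measurable R := measurable_pi_lambda _ fun i => (hm i).sub ((hm j).const_mul _)
  have hind : IndepFun (W j) R P := by
    have hpair : HasGaussianLaw (fun ω => ((fun _ : Unit => W j ω), R ω)) P := by
      let L : (Fin d → ℝ) →L[ℝ] (Unit → ℝ) × (Fin d → ℝ) :=
        (ContinuousLinearMap.pi fun _ => ContinuousLinearMap.proj j).prod
          (ContinuousLinearMap.pi fun i =>
            ContinuousLinearMap.proj i - ρ i • ContinuousLinearMap.proj j)
      exact hG.map_fun L
    have := HasGaussianLaw.indepFun_of_covariance_eval (X := fun _ : Unit => W j)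
      (Y := fun i ω => R ω i) hpair fun _ i => by
        simp only [hR]
        rw [covariance_fun_sub_right (hL2 j) (hL2 i) ((hL2 j).const_mul _),
          covariance_const_mul_right, covariance_self (hm j).aemeasurable, hvar]
        simp [hρ]
    exact this.comp (measurable_pi_apply ()) measurable_id
  have hprod : P.map (fun ω => (W j ω, R ω)) = (gaussianReal 0 1).prod (P.map R) := by
    rw [(indepFun_iff_map_prod_eq_prod_map_map (hm j).aemeasurable hRm.aemeasurable).1 hind, hlaw]
  have : IsProbabilityMeasure (P.map R) := Measure.isProbabilityMeasure_map hRm.aemeasurable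
  set W' : Fin d → ℝ × (Fin d → ℝ) → ℝ := fun i p => p.2 i + ρ i * p.1 with hW'
  set V : (Fin d → ℝ) → Set ℝ := fun r =>
    {t | ∀ i, r i + ρ i * t - z i ≤ t - z j ∧ (i < j → r i + ρ i * t - z i < t - z j)} with hV
  have hVup (r : Fin d → ℝ) : IsUpperSet (V r) := by
    intro t t' htt' ht i
    have h1 : ρ i * (t' - t) ≤ t' - t := mul_le_of_le_one_left (by linarith) (hρ1 i)
    have h2 := (ht i).1
    exact ⟨by linarith, fun hij => by have := (ht i).2 hij; linarith⟩
  have hTm : MeasurableSet {p : ℝ × (Fin d → ℝ) | p.1 ∈ V p.2} := by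
    have h1 (i : Fin d) : Measurable fun p : ℝ × (Fin d → ℝ) => p.2 i + ρ i * p.1 - z i := by
      fun_prop
    have h2 : Measurable fun p : ℝ × (Fin d → ℝ) => p.1 - z j := by fun_prop
    exact measurableSet_setOfPred.2 <| Measurable.forall fun i =>
      (measurableSet_setOfPred.1 (measurableSet_le (h1 i) h2)).and
        (measurable_const.imp (measurableSet_setOfPred.1 (measurableSet_lt (h1 i) h2)))
  have hsec (B : Set ℝ) (hB : MeasurableSet B) :
      P (firstArgmax W z j ∩ W j ⁻¹' B) = ∫⁻ r, gaussianReal 0 1 (V r ∩ B) ∂(P.map R) := by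
    have hT : MeasurableSet ({p : ℝ × (Fin d → ℝ) | p.1 ∈ V p.2} ∩ Prod.fst ⁻¹' B) :=
      hTm.inter (measurable_fst hB)
    have h1 : firstArgmax W z j ∩ W j ⁻¹' B = (fun ω => (W j ω, R ω)) ⁻¹'
        ({p : ℝ × (Fin d → ℝ) | p.1 ∈ V p.2} ∩ Prod.fst ⁻¹' B) := by
      ext ω
      simp [firstArgmax, hV, hR]
    rw [h1, ← Measure.map_apply ((hm j).prodMk hRm) hT, hprod, Measure.prod_apply_symm hT]
    rfl
  rw [hsec _ measurableSet_Ioc, hsec _ measurableSet_Ioi, ← lintegral_const_mul']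
  · exact lintegral_mono fun r => gaussianReal_std_upper_inter_Ioc_le (hVup r) hs hz hα hα'
  · exact ENNReal.ofReal_ne_top

/-- Nazarov's inequality for jointly Gaussian, standardised random variables. -/
theorem measureReal_forall_le_add_le (hd : 0 < d) (hm : ∀ i, Measurable (W i))
    (hG : HasGaussianLaw (fun ω i => W i ω) P) (hlaw : ∀ i, P.map (W i) = gaussianReal 0 1)
    (z : Fin d → ℝ) {α : ℝ} (hα : 0 ≤ α) (hα' : α ≤ 1 / 2) :
    P.real {ω | ∀ i, W i ω ≤ z i + α} ≤
      P.real {ω | ∀ i, W i ω ≤ z i} + (√(2 * Real.log d) + 2) * α := by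
  have : Nonempty (Fin d) := ⟨⟨0, hd⟩⟩
  have hd0 : (0 : ℝ) < d := by exact_mod_cast hd
  set s : ℝ := √(2 * Real.log d) with hs
  have hs0 : 0 ≤ s := Real.sqrt_nonneg _
  have hAm (j : Fin d) := measurableSet_firstArgmax hm z j
  have hsub : {ω | ∀ i, W i ω ≤ z i + α} ⊆ {ω | ∀ i, W i ω ≤ z i} ∪
      ⋃ j, firstArgmax W z j ∩ W j ⁻¹' Set.Ioc (z j) (z j + α) := by
    intro ω hω
    by_cases h : ∀ i, W i ω ≤ z i
    · exact Or.inl h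
    · push Not at h
      obtain ⟨i, hi⟩ := h
      obtain ⟨j, hj⟩ := exists_mem_firstArgmax (W := W) z ω
      refine Or.inr (Set.mem_iUnion.2 ⟨j, hj, ?_, hω j⟩)
      linarith [(hj i).1]
  have hterm (j : Fin d) : P.real (firstArgmax W z j ∩ W j ⁻¹' Set.Ioc (z j) (z j + α)) ≤
      (s + 3 / 2) * α * P.real (firstArgmax W z j ∩ W j ⁻¹' Set.Ioi (z j)) + (2 * (d : ℝ))⁻¹ * α := by
    rcases le_total (z j) s with hz | hz
    · have h1 := ENNReal.toReal_mono (ENNReal.mul_ne_top ENNReal.ofReal_ne_top (measure_ne_top _ _))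
        (measure_firstArgmax_inter_Ioc_le hm hG hlaw z j hs0 hz hα hα')
      rw [ENNReal.toReal_mul, ENNReal.toReal_ofReal (by positivity)] at h1
      have : 0 ≤ (2 * (d : ℝ))⁻¹ * α := by positivity
      exact h1.trans (le_add_of_nonneg_right this)
    · have h1 : P.real (firstArgmax W z j ∩ W j ⁻¹' Set.Ioc (z j) (z j + α)) ≤
          (gaussianReal 0 1).real (Set.Ioc (z j) (z j + α)) := by
        rw [← hlaw j, map_measureReal_apply (hm j) measurableSet_Ioc]
        exact measureReal_mono Set.inter_subset_right
      have h2 : (gaussianReal 0 1).real (Set.Ioc (z j) (z j + α)) ≤ (2 * (d : ℝ))⁻¹ * α := by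
        refine gaussianReal_std_real_le_of_pdf_le hα (by positivity) subset_rfl fun x hx => ?_
        refine (gaussianPDFReal_std_le ?_).trans (gaussianPDFReal_std_sqrt_two_log_le hd)
        rw [abs_of_nonneg hs0]
        exact (hz.trans hx.1.le).trans (le_abs_self x)
      refine (h1.trans h2).trans (le_add_of_nonneg_left ?_)
      positivity
  -- Breaking ties by the first index makes these events disjoint, so no union bound over d is paid.
  have hsum : ∑ j, P.real (firstArgmax W z j ∩ W j ⁻¹' Set.Ioi (z j)) ≤ 1 := by
    rw [← measureReal_iUnion_fintype (fun i j hij => ((pairwise_disjoint_firstArgmax z hij).mono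
      Set.inter_subset_left Set.inter_subset_left))
      fun j => (hAm j).inter (hm j measurableSet_Ioi)]
    exact measureReal_le_one
  calc P.real {ω | ∀ i, W i ω ≤ z i + α}
      ≤ P.real {ω | ∀ i, W i ω ≤ z i} +
        P.real (⋃ j, firstArgmax W z j ∩ W j ⁻¹' Set.Ioc (z j) (z j + α)) :=
        (measureReal_mono hsub).trans (measureReal_union_le _ _)
    _ ≤ P.real {ω | ∀ i, W i ω ≤ z i} +
        ∑ j, ((s + 3 / 2) * α * P.real (firstArgmax W z j ∩ W j ⁻¹' Set.Ioi (z j))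
          + (2 * (d : ℝ))⁻¹ * α) := by
        gcongr
        exact (measureReal_iUnion_fintype_le _).trans (Finset.sum_le_sum fun j _ => hterm j)
    _ ≤ _ := by
        rw [Finset.sum_add_distrib, ← Finset.mul_sum, Finset.sum_const, Finset.card_univ,
          Fintype.card_fin, nsmul_eq_mul]
        have h1 : (s + 3 / 2) * α * ∑ j, P.real (firstArgmax W z j ∩ W j ⁻¹' Set.Ioi (z j))
            ≤ (s + 3 / 2) * α * 1 := by gcongr
        have h2 : (d : ℝ) * ((2 * (d : ℝ))⁻¹ * α) = α / 2 := by field_simp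
        rw [h2]
        linarith

end Window

/-- After standardising, a shift by t in coordinate j becomes t/√(S j j) ≤ t/σ. Singular covariances
need no separate treatment, as only the marginals are normalised. -/
theorem orthantLip_multivariateGaussian {d : ℕ} (μ : EuclideanSpace ℝ (Fin d))
    {S : Matrix (Fin d) (Fin d) ℝ} (hS : S.PosSemidef) {σ : ℝ} (hd : 0 < d) (hσ0 : 0 < σ)
    (hσ : ∀ j, σ ≤ √(S j j)) :
    OrthantLip (multivariateGaussian μ S) ((√(2 * Real.log d) + 2) / σ) := by
  intro z t ht
  set ν := multivariateGaussian μ S with hν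
  have hsq := Real.sqrt_nonneg (2 * Real.log d)
  -- For t/σ ≥ 1/2 the claimed bound exceeds 1, because the constant is at least 2/σ.
  rcases le_or_gt (1 / 2) (t / σ) with h | h
  · have h1 : ν.real (orthant (diagShift z t)) ≤ 1 := measureReal_le_one
    have h2 : (√(2 * Real.log d) + 2) / σ * t = (√(2 * Real.log d) + 2) * (t / σ) := by ring
    have h3 : 2 * (1 / 2) ≤ (√(2 * Real.log d) + 2) * (t / σ) := by
      gcongr
      linarith
    rw [h2]
    linarith [measureReal_nonneg (μ := ν) (s := orthant z)]
  have hs (j : Fin d) : 0 < √(S j j) := hσ0.trans_le (hσ j)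
  set W : Fin d → EuclideanSpace ℝ (Fin d) → ℝ := fun j x => (√(S j j))⁻¹ * (x j - μ j) with hW
  have hm (j : Fin d) : Measurable (W j) := by
    simp only [hW]
    fun_prop
  have hG : HasGaussianLaw (fun x i => W i x) ν := by
    have h0 : HasGaussianLaw (fun x : EuclideanSpace ℝ (Fin d) => x + -μ) ν := by
      constructor
      infer_instance
    let L : EuclideanSpace ℝ (Fin d) →L[ℝ] (Fin d → ℝ) := ContinuousLinearMap.pi fun i =>
      (√(S i i))⁻¹ • (EuclideanSpace.proj i : EuclideanSpace ℝ (Fin d) →L[ℝ] ℝ)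
    have e : (fun x i => W i x) = fun x => L (x + -μ) := by
      ext x i
      simp [hW, L, sub_eq_add_neg]
    rw [e]
    exact h0.map_fun L
  have hlaw (j : Fin d) : ν.map (W j) = gaussianReal 0 1 := by
    have h1 := (measurePreserving_eval_multivariateGaussian (μ := μ) hS (i := j)).map_eq
    have h2 : W j = (fun y => (√(S j j))⁻¹ * y) ∘ (fun y => y - μ j) ∘
        fun x : EuclideanSpace ℝ (Fin d) => x j := rfl
    rw [h2, ← Measure.map_map (by fun_prop) (by fun_prop),
      ← Measure.map_map (by fun_prop) (by fun_prop), h1, gaussianReal_map_sub_const,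
      gaussianReal_map_const_mul]
    have hSj : 0 < S j j := Real.sqrt_pos.1 (hs j)
    congr 1
    · simp
    · ext
      simp [Real.sq_sqrt hSj.le, hSj.le, hSj.ne']
  have key := measureReal_forall_le_add_le hd hm hG hlaw (fun j => (√(S j j))⁻¹ * (z j - μ j))
    (div_nonneg ht hσ0.le) h.le
  have e1 : {x | ∀ i, W i x ≤ (√(S i i))⁻¹ * (z i - μ i)} = orthant z := by
    ext x
    simp only [hW, Set.mem_ofPred_eq, orthant]
    refine forall_congr' fun i => ?_
    rw [mul_le_mul_iff_right₀ (inv_pos.2 (hs i)), sub_le_sub_iff_right]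
  have e2 : orthant (diagShift z t) ⊆
      {x | ∀ i, W i x ≤ (√(S i i))⁻¹ * (z i - μ i) + t / σ} := by
    intro x hx i
    have h1 : x i ≤ z i + t := hx i
    have h2 : (√(S i i))⁻¹ * t ≤ t / σ := by
      rw [inv_mul_eq_div]
      exact div_le_div_of_nonneg_left ht hσ0 (hσ i)
    have h3 : (√(S i i))⁻¹ * (x i - μ i) ≤ (√(S i i))⁻¹ * (z i + t - μ i) := by
      have := hs i
      gcongr
    calc W i x ≤ (√(S i i))⁻¹ * (z i + t - μ i) := h3
      _ = (√(S i i))⁻¹ * (z i - μ i) + (√(S i i))⁻¹ * t := by ring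
      _ ≤ _ := by gcongr
  rw [e1] at key
  refine (measureReal_mono e2).trans (key.trans (le_of_eq ?_))
  ring

/-! ### Spline steps of order three and four. -/

/-- The truncated power `x ↦ (x - s)₊ ^ n`. -/
noncomputable def truncPow (n : ℕ) (s x : ℝ) : ℝ := max (x - s) 0 ^ n

/-- For n = 0 the one-sided derivatives differ at the knot, hence `s ≤ x` here and `s < x` for the
left derivative. -/
theorem hasDerivWithinAt_truncPow_right (n : ℕ) (s x : ℝ) :
    HasDerivWithinAt (truncPow (n + 1) s)
      (if s ≤ x then ((n + 1 : ℕ) : ℝ) * (x - s) ^ n else 0) (Set.Ici x) x := by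
  split_ifs with h
  · have h1 : HasDerivAt (fun y : ℝ => (y - s) ^ (n + 1)) (((n + 1 : ℕ) : ℝ) * (x - s) ^ n) x := by
      simpa using ((hasDerivAt_id x).sub_const s).fun_pow (n + 1)
    refine h1.hasDerivWithinAt.congr (fun y hy => ?_) ?_
    · have : x ≤ y := hy
      rw [truncPow, max_eq_left (by linarith)]
    · rw [truncPow, max_eq_left (by linarith)]
  · push Not at h
    refine HasDerivAt.hasDerivWithinAt ((hasDerivAt_const x (0 : ℝ)).congr_of_eventuallyEq ?_)
    filter_upwards [Iio_mem_nhds h] with y hy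
    have : y < s := hy
    rw [truncPow, max_eq_right (by linarith), zero_pow (Nat.succ_ne_zero n)]

theorem hasDerivWithinAt_truncPow_left (n : ℕ) (s x : ℝ) :
    HasDerivWithinAt (truncPow (n + 1) s)
      (if s < x then ((n + 1 : ℕ) : ℝ) * (x - s) ^ n else 0) (Set.Iic x) x := by
  split_ifs with h
  · have h1 : HasDerivAt (fun y : ℝ => (y - s) ^ (n + 1)) (((n + 1 : ℕ) : ℝ) * (x - s) ^ n) x := by
      simpa using ((hasDerivAt_id x).sub_const s).fun_pow (n + 1)
    refine (h1.congr_of_eventuallyEq ?_).hasDerivWithinAt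
    filter_upwards [Ioi_mem_nhds h] with y hy
    have : s < y := hy
    rw [truncPow, max_eq_left (by linarith)]
  · push Not at h
    refine (hasDerivWithinAt_const x _ (0 : ℝ)).congr (fun y hy => ?_) ?_
    · have : y ≤ x := hy
      rw [truncPow, max_eq_right (by linarith), zero_pow (Nat.succ_ne_zero n)]
    · rw [truncPow, max_eq_right (by linarith), zero_pow (Nat.succ_ne_zero n)]

theorem hasDerivAt_truncPow (n : ℕ) (s x : ℝ) :
    HasDerivAt (truncPow (n + 2) s) (((n + 2 : ℕ) : ℝ) * truncPow (n + 1) s x) x := by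
  have hr := hasDerivWithinAt_truncPow_right (n + 1) s x
  have hl := hasDerivWithinAt_truncPow_left (n + 1) s x
  have e1 : (if s ≤ x then ((n + 1 + 1 : ℕ) : ℝ) * (x - s) ^ (n + 1) else 0)
      = ((n + 2 : ℕ) : ℝ) * truncPow (n + 1) s x := by
    split_ifs with h
    · rw [truncPow, max_eq_left (by linarith)]
    · rw [truncPow, max_eq_right (by linarith), zero_pow (Nat.succ_ne_zero n), mul_zero]
  have e2 : (if s < x then ((n + 1 + 1 : ℕ) : ℝ) * (x - s) ^ (n + 1) else 0)
      = ((n + 2 : ℕ) : ℝ) * truncPow (n + 1) s x := by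
    split_ifs with h
    · rw [truncPow, max_eq_left (by linarith)]
    · rw [truncPow, max_eq_right (by linarith), zero_pow (Nat.succ_ne_zero n), mul_zero]
  rw [e1] at hr
  rw [e2] at hl
  have := hl.union hr
  rwa [Set.Iic_union_Ici, hasDerivWithinAt_univ] at this

section Cubic

/-- The alternating sum of truncated powers with knots `-1, -1/2, 1/2, 1`. -/
noncomputable def cubicSpline (n : ℕ) (x : ℝ) : ℝ :=
  truncPow n (-1) x - 2 * truncPow n (-1 / 2) x + 2 * truncPow n (1 / 2) x - truncPow n 1 x

/-- The smooth step of order three and its derivatives. -/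
noncomputable def cubicStep : ℕ → ℝ → ℝ
  | 0, x => 1 - 2 / 3 * cubicSpline 3 x
  | 1, x => -2 * cubicSpline 2 x
  | 2, x => -4 * cubicSpline 1 x
  | _, _ => 0

theorem hasDerivAt_cubicSpline (n : ℕ) (x : ℝ) :
    HasDerivAt (cubicSpline (n + 2)) (((n + 2 : ℕ) : ℝ) * cubicSpline (n + 1) x) x := by
  have h := (((hasDerivAt_truncPow n (-1) x).sub
    ((hasDerivAt_truncPow n (-1 / 2) x).const_mul 2)).add
    ((hasDerivAt_truncPow n (1 / 2) x).const_mul 2)).sub (hasDerivAt_truncPow n 1 x)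
  refine h.congr_deriv ?_
  unfold cubicSpline
  ring

theorem cubicSpline_cases (n : ℕ) (x : ℝ) :
    (x ≤ -1 ∧ cubicSpline (n + 1) x = 0) ∨
    (-1 ≤ x ∧ x ≤ -1 / 2 ∧ cubicSpline (n + 1) x = (x + 1) ^ (n + 1)) ∨
    (-1 / 2 ≤ x ∧ x ≤ 1 / 2 ∧
      cubicSpline (n + 1) x = (x + 1) ^ (n + 1) - 2 * (x + 1 / 2) ^ (n + 1)) ∨
    (1 / 2 ≤ x ∧ x ≤ 1 ∧ cubicSpline (n + 1) x =
      (x + 1) ^ (n + 1) - 2 * (x + 1 / 2) ^ (n + 1) + 2 * (x - 1 / 2) ^ (n + 1)) ∨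
    (1 ≤ x ∧ cubicSpline (n + 1) x = (x + 1) ^ (n + 1) - 2 * (x + 1 / 2) ^ (n + 1)
      + 2 * (x - 1 / 2) ^ (n + 1) - (x - 1) ^ (n + 1)) := by
  have h0 : (0 : ℝ) ^ (n + 1) = 0 := zero_pow (Nat.succ_ne_zero n)
  have e1 : x - -1 = x + 1 := by ring
  have e2 : x - -1 / 2 = x + 1 / 2 := by ring
  simp only [cubicSpline, truncPow, e1, e2]
  rcases le_total x (-1) with h1 | h1
  · left
    rw [max_eq_right (by linarith : x + 1 ≤ 0), max_eq_right (by linarith : x + 1 / 2 ≤ 0),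
      max_eq_right (by linarith : x - 1 / 2 ≤ 0), max_eq_right (by linarith : x - 1 ≤ 0), h0]
    exact ⟨h1, by ring⟩
  rcases le_total x (-1 / 2) with h2 | h2
  · right; left
    rw [max_eq_left (by linarith : 0 ≤ x + 1), max_eq_right (by linarith : x + 1 / 2 ≤ 0),
      max_eq_right (by linarith : x - 1 / 2 ≤ 0), max_eq_right (by linarith : x - 1 ≤ 0), h0]
    exact ⟨h1, h2, by ring⟩
  rcases le_total x (1 / 2) with h3 | h3
  · right; right; left
    rw [max_eq_left (by linarith : 0 ≤ x + 1), max_eq_left (by linarith : 0 ≤ x + 1 / 2),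
      max_eq_right (by linarith : x - 1 / 2 ≤ 0), max_eq_right (by linarith : x - 1 ≤ 0), h0]
    exact ⟨h2, h3, by ring⟩
  rcases le_total x 1 with h4 | h4
  · right; right; right; left
    rw [max_eq_left (by linarith : 0 ≤ x + 1), max_eq_left (by linarith : 0 ≤ x + 1 / 2),
      max_eq_left (by linarith : 0 ≤ x - 1 / 2), max_eq_right (by linarith : x - 1 ≤ 0), h0]
    exact ⟨h3, h4, by ring⟩
  · right; right; right; right
    rw [max_eq_left (by linarith : 0 ≤ x + 1), max_eq_left (by linarith : 0 ≤ x + 1 / 2),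
      max_eq_left (by linarith : 0 ≤ x - 1 / 2), max_eq_left (by linarith : 0 ≤ x - 1)]
    exact ⟨h4, rfl⟩

theorem cubicSpline_three_mem_Icc (x : ℝ) : cubicSpline 3 x ∈ Set.Icc (0 : ℝ) (3 / 2) := by
  rcases cubicSpline_cases 2 x with ⟨h, e⟩ | ⟨h, h', e⟩ | ⟨h, h', e⟩ | ⟨h, h', e⟩ | ⟨h, e⟩ <;>
    rw [show 2 + 1 = 3 from rfl] at e <;> rw [e]
  · norm_num
  · have h0 : 0 ≤ x + 1 := by linarith
    exact ⟨by positivity, (pow_le_one₀ h0 (by linarith)).trans (by norm_num)⟩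
  · constructor <;> nlinarith [mul_nonneg (sub_nonneg.2 h) (sub_nonneg.2 h'), sq_nonneg x]
  · have h0 : 0 ≤ 1 - x := by linarith
    have h1 : (1 - x) ^ 3 ≤ 1 := pow_le_one₀ h0 (by linarith)
    have e : (x + 1) ^ 3 - 2 * (x + 1 / 2) ^ 3 + 2 * (x - 1 / 2) ^ 3 = 3 / 2 - (1 - x) ^ 3 := by
      ring
    rw [e]
    exact ⟨by linarith, by linarith [pow_nonneg h0 3]⟩
  · have e : (x + 1) ^ 3 - 2 * (x + 1 / 2) ^ 3 + 2 * (x - 1 / 2) ^ 3 - (x - 1) ^ 3 = 3 / 2 := by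
      ring
    rw [e]
    norm_num

theorem abs_cubicSpline_one_le (x : ℝ) : |cubicSpline 1 x| ≤ 1 / 2 := by
  rcases cubicSpline_cases 0 x with ⟨h, e⟩ | ⟨h, h', e⟩ | ⟨h, h', e⟩ | ⟨h, h', e⟩ | ⟨h, e⟩ <;>
    rw [show 0 + 1 = 1 from rfl] at e <;> rw [e, abs_le] <;> constructor <;> linarith

/-- The knots are the Chebyshev points cos(kπ/3), and the third derivative is ±4 with alternating
signs between them and 0 outside. The value 4 is M'_3. -/
theorem exists_deriv_cubicStep_right (x : ℝ) :
    ∃ r : ℝ, r ^ 2 ≤ 16 ∧ HasDerivWithinAt (cubicStep 2) r (Set.Ici x) x := by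
  have h := ((((hasDerivWithinAt_truncPow_right 0 (-1) x).sub
    ((hasDerivWithinAt_truncPow_right 0 (-1 / 2) x).const_mul 2)).add
    ((hasDerivWithinAt_truncPow_right 0 (1 / 2) x).const_mul 2)).sub
    (hasDerivWithinAt_truncPow_right 0 1 x)).const_mul (-4)
  refine ⟨_, ?_, h⟩
  split_ifs <;> first | (exfalso; linarith) | norm_num

theorem exists_deriv_cubicStep_left (x : ℝ) :
    ∃ r : ℝ, r ^ 2 ≤ 16 ∧ HasDerivWithinAt (cubicStep 2) r (Set.Iic x) x := by
  have h := ((((hasDerivWithinAt_truncPow_left 0 (-1) x).sub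
    ((hasDerivWithinAt_truncPow_left 0 (-1 / 2) x).const_mul 2)).add
    ((hasDerivWithinAt_truncPow_left 0 (1 / 2) x).const_mul 2)).sub
    (hasDerivWithinAt_truncPow_left 0 1 x)).const_mul (-4)
  refine ⟨_, ?_, h⟩
  split_ifs <;> first | (exfalso; linarith) | norm_num

end Cubic

section Quartic

/-- The alternating sum of truncated powers with knots `-1, -√2/2, 0, √2/2, 1`. -/
noncomputable def quarticSpline (n : ℕ) (x : ℝ) : ℝ :=
  truncPow n (-1) x - 2 * truncPow n (-(√2 / 2)) x + 2 * truncPow n 0 x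
    - 2 * truncPow n (√2 / 2) x + truncPow n 1 x

/-- The smooth step of order four and its derivatives. -/
noncomputable def quarticStep : ℕ → ℝ → ℝ
  | 0, x => 1 - quarticSpline 4 x
  | 1, x => -4 * quarticSpline 3 x
  | 2, x => -12 * quarticSpline 2 x
  | 3, x => -24 * quarticSpline 1 x
  | _, _ => 0

theorem hasDerivAt_quarticSpline (n : ℕ) (x : ℝ) :
    HasDerivAt (quarticSpline (n + 2)) (((n + 2 : ℕ) : ℝ) * quarticSpline (n + 1) x) x := by
  have h := ((((hasDerivAt_truncPow n (-1) x).sub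
    ((hasDerivAt_truncPow n (-(√2 / 2)) x).const_mul 2)).add
    ((hasDerivAt_truncPow n 0 x).const_mul 2)).sub
    ((hasDerivAt_truncPow n (√2 / 2) x).const_mul 2)).add (hasDerivAt_truncPow n 1 x)
  refine h.congr_deriv ?_
  unfold quarticSpline
  ring

theorem sq_sqrt_two_div_two : (√2 / 2 : ℝ) ^ 2 = 1 / 2 := by
  rw [div_pow, Real.sq_sqrt zero_le_two]
  norm_num

theorem sqrt_two_div_two_mem_Icc : √2 / 2 ∈ Set.Icc (7 / 10 : ℝ) (17 / 24) := by
  have h := sq_sqrt_two_div_two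
  have h0 : 0 ≤ √2 / 2 := by positivity
  constructor <;> nlinarith

theorem quarticSpline_cases (n : ℕ) (x : ℝ) {a : ℝ} (ha : a = √2 / 2) :
    (x ≤ -1 ∧ quarticSpline (n + 1) x = 0) ∨
    (-1 ≤ x ∧ x ≤ -a ∧ quarticSpline (n + 1) x = (x + 1) ^ (n + 1)) ∨
    (-a ≤ x ∧ x ≤ 0 ∧ quarticSpline (n + 1) x = (x + 1) ^ (n + 1) - 2 * (x + a) ^ (n + 1)) ∨
    (0 ≤ x ∧ x ≤ a ∧ quarticSpline (n + 1) x =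
      (x + 1) ^ (n + 1) - 2 * (x + a) ^ (n + 1) + 2 * x ^ (n + 1)) ∨
    (a ≤ x ∧ x ≤ 1 ∧ quarticSpline (n + 1) x = (x + 1) ^ (n + 1) - 2 * (x + a) ^ (n + 1)
      + 2 * x ^ (n + 1) - 2 * (x - a) ^ (n + 1)) ∨
    (1 ≤ x ∧ quarticSpline (n + 1) x = (x + 1) ^ (n + 1) - 2 * (x + a) ^ (n + 1)
      + 2 * x ^ (n + 1) - 2 * (x - a) ^ (n + 1) + (x - 1) ^ (n + 1)) := by
  have h0 : (0 : ℝ) ^ (n + 1) = 0 := zero_pow (Nat.succ_ne_zero n)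
  obtain ⟨ha1, ha2⟩ := sqrt_two_div_two_mem_Icc
  simp only [quarticSpline, truncPow, ← ha, sub_neg_eq_add, sub_zero]
  rw [← ha] at ha1 ha2
  rcases le_total x (-1) with h1 | h1
  · left
    rw [max_eq_right (by linarith : x + 1 ≤ 0), max_eq_right (by linarith : x + a ≤ 0),
      max_eq_right (by linarith : x ≤ 0), max_eq_right (by linarith : x - a ≤ 0),
      max_eq_right (by linarith : x - 1 ≤ 0), h0]
    exact ⟨h1, by ring⟩
  rcases le_total x (-a) with h2 | h2
  · right; left
    rw [max_eq_left (by linarith : 0 ≤ x + 1), max_eq_right (by linarith : x + a ≤ 0),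
      max_eq_right (by linarith : x ≤ 0), max_eq_right (by linarith : x - a ≤ 0),
      max_eq_right (by linarith : x - 1 ≤ 0), h0]
    exact ⟨h1, h2, by ring⟩
  rcases le_total x 0 with h3 | h3
  · right; right; left
    rw [max_eq_left (by linarith : 0 ≤ x + 1), max_eq_left (by linarith : 0 ≤ x + a),
      max_eq_right (by linarith : x ≤ 0), max_eq_right (by linarith : x - a ≤ 0),
      max_eq_right (by linarith : x - 1 ≤ 0), h0]
    exact ⟨h2, h3, by ring⟩
  rcases le_total x a with h4 | h4
  · right; right; right; left
    rw [max_eq_left (by linarith : 0 ≤ x + 1), max_eq_left (by linarith : 0 ≤ x + a),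
      max_eq_left h3, max_eq_right (by linarith : x - a ≤ 0),
      max_eq_right (by linarith : x - 1 ≤ 0), h0]
    exact ⟨h3, h4, by ring⟩
  rcases le_total x 1 with h5 | h5
  · right; right; right; right; left
    rw [max_eq_left (by linarith : 0 ≤ x + 1), max_eq_left (by linarith : 0 ≤ x + a),
      max_eq_left h3, max_eq_left (by linarith : 0 ≤ x - a),
      max_eq_right (by linarith : x - 1 ≤ 0), h0]
    exact ⟨h4, h5, by ring⟩
  · right; right; right; right; right
    rw [max_eq_left (by linarith : 0 ≤ x + 1), max_eq_left (by linarith : 0 ≤ x + a),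
      max_eq_left h3, max_eq_left (by linarith : 0 ≤ x - a), max_eq_left (by linarith : 0 ≤ x - 1)]
    exact ⟨h5, rfl⟩

/-- Since y ≤ 1, one has y - (1 - a) ≤ ay, and 2(17/24)^4 < 1. Used with y = 1 + x and y = 1 - x, it
gives the sign of the spline next to the centre. -/
theorem two_mul_sub_pow_four_le {a y : ℝ} (ha2 : a ≤ 17 / 24) (hy : 1 - a ≤ y)
    (hy1 : y ≤ 1) : 2 * (y - (1 - a)) ^ 4 ≤ y ^ 4 := by
  have h0 : 0 ≤ y - (1 - a) := by linarith
  have h1 : y - (1 - a) ≤ 17 / 24 * y := by nlinarith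
  calc 2 * (y - (1 - a)) ^ 4 ≤ 2 * (17 / 24 * y) ^ 4 := by gcongr
    _ = 2 * (17 / 24) ^ 4 * y ^ 4 := by ring
    _ ≤ 1 * y ^ 4 := by gcongr; norm_num
    _ = y ^ 4 := one_mul _

theorem quarticSpline_four_mem_Icc (x : ℝ) : quarticSpline 4 x ∈ Set.Icc (0 : ℝ) 1 := by
  obtain ⟨ha1, ha2⟩ := sqrt_two_div_two_mem_Icc
  have ha := sq_sqrt_two_div_two
  generalize hadef : √2 / 2 = a at ha ha1 ha2
  rcases quarticSpline_cases 3 x hadef.symm with ⟨h, e⟩ | ⟨h, h', e⟩ | ⟨h, h', e⟩ | ⟨h, h', e⟩ |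
    ⟨h, h', e⟩ | ⟨h, e⟩ <;> rw [show 3 + 1 = 4 from rfl] at e <;> rw [e]
  · norm_num
  · have h0 : 0 ≤ x + 1 := by linarith
    exact ⟨by positivity, pow_le_one₀ h0 (by linarith)⟩
  · have h0 : 0 ≤ x + 1 := by linarith
    have h1 := two_mul_sub_pow_four_le (y := x + 1) ha2 (by linarith) (by linarith)
    have e1 : x + 1 - (1 - a) = x + a := by ring
    rw [e1] at h1
    have h2 : (x + 1) ^ 4 ≤ 1 := pow_le_one₀ h0 (by linarith)
    have h3 : 0 ≤ (x + a) ^ 4 := by positivity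
    exact ⟨by linarith, by linarith⟩
  · have h0 : 0 ≤ 1 - x := by linarith
    have h1 := two_mul_sub_pow_four_le (y := 1 - x) ha2 (by linarith) (by linarith)
    have e1 : 1 - x - (1 - a) = a - x := by ring
    rw [e1] at h1
    have h2 : (1 - x) ^ 4 ≤ 1 := pow_le_one₀ h0 (by linarith)
    have h3 : 0 ≤ (a - x) ^ 4 := by positivity
    -- The spline is symmetric about the point (0, 1/2); this rests on a² = 1/2.
    have e2 : (x + 1) ^ 4 - 2 * (x + a) ^ 4 + 2 * x ^ 4 = 1 - ((1 - x) ^ 4 - 2 * (a - x) ^ 4) := by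
      linear_combination (-24 * x ^ 2 - 4 * (a ^ 2 + 1 / 2)) * ha
    rw [e2]
    exact ⟨by linarith, by linarith⟩
  · have h0 : 0 ≤ 1 - x := by linarith
    have h2 : (1 - x) ^ 4 ≤ 1 := pow_le_one₀ h0 (by linarith)
    have e2 : (x + 1) ^ 4 - 2 * (x + a) ^ 4 + 2 * x ^ 4 - 2 * (x - a) ^ 4 = 1 - (1 - x) ^ 4 := by
      linear_combination (-24 * x ^ 2 - 4 * (a ^ 2 + 1 / 2)) * ha
    rw [e2]
    exact ⟨by linarith, by linarith [pow_nonneg h0 4]⟩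
  · have e2 : (x + 1) ^ 4 - 2 * (x + a) ^ 4 + 2 * x ^ 4 - 2 * (x - a) ^ 4 + (x - 1) ^ 4 = 1 := by
      linear_combination (-24 * x ^ 2 - 4 * (a ^ 2 + 1 / 2)) * ha
    rw [e2]
    norm_num

theorem abs_quarticSpline_two_le (x : ℝ) : |quarticSpline 2 x| ≤ 5 / 24 := by
  obtain ⟨ha1, ha2⟩ := sqrt_two_div_two_mem_Icc
  have ha := sq_sqrt_two_div_two
  generalize hadef : √2 / 2 = a at ha ha1 ha2
  rcases quarticSpline_cases 1 x hadef.symm with ⟨h, e⟩ | ⟨h, h', e⟩ | ⟨h, h', e⟩ | ⟨h, h', e⟩ |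
    ⟨h, h', e⟩ | ⟨h, e⟩ <;> rw [show 1 + 1 = 2 from rfl] at e <;> rw [e]
  · norm_num
  · rw [abs_le]
    constructor <;> nlinarith
  · have e1 : (x + 1) ^ 2 - 2 * (x + a) ^ 2 = -x * (x + 4 * a - 2) := by
      linear_combination -2 * ha
    rw [e1, abs_le]
    constructor <;> nlinarith [sq_nonneg (x + 2 * a - 1)]
  · have e1 : (x + 1) ^ 2 - 2 * (x + a) ^ 2 + 2 * x ^ 2 = -x * (4 * a - 2 - x) := by
      linear_combination -2 * ha
    rw [e1, abs_le]
    constructor <;> nlinarith [sq_nonneg (x - 2 * a + 1)]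
  · have e1 : (x + 1) ^ 2 - 2 * (x + a) ^ 2 + 2 * x ^ 2 - 2 * (x - a) ^ 2 = -(1 - x) ^ 2 := by
      linear_combination -4 * ha
    rw [e1, abs_le]
    constructor <;> nlinarith
  · have e1 : (x + 1) ^ 2 - 2 * (x + a) ^ 2 + 2 * x ^ 2 - 2 * (x - a) ^ 2 + (x - 1) ^ 2 = 0 := by
      linear_combination -4 * ha
    rw [e1]
    norm_num

theorem abs_quarticSpline_one_le (x : ℝ) : |quarticSpline 1 x| ≤ 5 / 12 := by
  obtain ⟨ha1, ha2⟩ := sqrt_two_div_two_mem_Icc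
  generalize hadef : √2 / 2 = a at ha1 ha2
  rcases quarticSpline_cases 0 x hadef.symm with ⟨h, e⟩ | ⟨h, h', e⟩ | ⟨h, h', e⟩ | ⟨h, h', e⟩ |
    ⟨h, h', e⟩ | ⟨h, e⟩ <;> rw [show 0 + 1 = 1 from rfl] at e <;> rw [e, abs_le] <;>
    constructor <;> linarith

/-- The knots are cos(kπ/4), and the fourth derivative is ±24 between them, with 24 = M'_4 and 576 =
24². -/
theorem exists_deriv_quarticStep_right (x : ℝ) :
    ∃ r : ℝ, r ^ 2 ≤ 576 ∧ HasDerivWithinAt (quarticStep 3) r (Set.Ici x) x := by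
  have h := (((((hasDerivWithinAt_truncPow_right 0 (-1) x).sub
    ((hasDerivWithinAt_truncPow_right 0 (-(√2 / 2)) x).const_mul 2)).add
    ((hasDerivWithinAt_truncPow_right 0 0 x).const_mul 2)).sub
    ((hasDerivWithinAt_truncPow_right 0 (√2 / 2) x).const_mul 2)).add
    (hasDerivWithinAt_truncPow_right 0 1 x)).const_mul (-24)
  refine ⟨_, ?_, h⟩
  obtain ⟨ha1, ha2⟩ := sqrt_two_div_two_mem_Icc
  generalize √2 / 2 = a at ha1 ha2 ⊢
  split_ifs <;> first | (exfalso; linarith) | norm_num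

theorem exists_deriv_quarticStep_left (x : ℝ) :
    ∃ r : ℝ, r ^ 2 ≤ 576 ∧ HasDerivWithinAt (quarticStep 3) r (Set.Iic x) x := by
  have h := (((((hasDerivWithinAt_truncPow_left 0 (-1) x).sub
    ((hasDerivWithinAt_truncPow_left 0 (-(√2 / 2)) x).const_mul 2)).add
    ((hasDerivWithinAt_truncPow_left 0 0 x).const_mul 2)).sub
    ((hasDerivWithinAt_truncPow_left 0 (√2 / 2) x).const_mul 2)).add
    (hasDerivWithinAt_truncPow_left 0 1 x)).const_mul (-24)
  refine ⟨_, ?_, h⟩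
  obtain ⟨ha1, ha2⟩ := sqrt_two_div_two_mem_Icc
  generalize √2 / 2 = a at ha1 ha2 ⊢
  split_ifs <;> first | (exfalso; linarith) | norm_num

end Quartic

/-- For a function with values in `[0, 1]` and second derivative bounded by `A`, both
`f' ^ 2 ≤ 2 A (1 - f ^ 2)` and `f' ^ 2 ≤ A`. -/
theorem sq_deriv_le_of_mem_Icc {f f' f'' : ℝ → ℝ} {A : ℝ} (hA : 0 < A)
    (hf : ∀ x, HasDerivAt f (f' x) x) (hf' : ∀ x, HasDerivAt f' (f'' x) x)
    (h1 : ∀ x, f x ∈ Set.Icc (0 : ℝ) 1) (h2 : ∀ x, |f'' x| ≤ A) (x : ℝ) :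
    f' x ^ 2 ≤ 2 * A * (1 - f x ^ 2) ∧ f' x ^ 2 ≤ A := by
  -- Applied to f and to 1 - f, the parabola bound gives f'^2 ≤ 2A min(f, 1 - f) ≤ A; moreover 1 - f
  -- ≤ 1 - f².
  have k1 := sq_deriv_le_of_le_one hA hf hf' (fun x => (h1 x).2) (fun x => (abs_le.1 (h2 x)).1) x
  have k2 := sq_deriv_le_of_le_one (f := fun x => 1 - f x) (f' := fun x => -f' x)
    (f'' := fun x => -f'' x) hA (fun x => (hf x).const_sub 1) (fun x => (hf' x).neg)
    (fun x => by linarith [(h1 x).1]) (fun x => by linarith [(abs_le.1 (h2 x)).2]) x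
  have h3 := h1 x
  constructor
  · refine k1.trans (mul_le_mul_of_nonneg_left ?_ (by positivity))
    nlinarith [h3.1, h3.2]
  · nlinarith

theorem cubicStep_mem_Icc (x : ℝ) : cubicStep 0 x ∈ Set.Icc (0 : ℝ) 1 := by
  have := cubicSpline_three_mem_Icc x
  simp only [cubicStep]
  exact ⟨by linarith [this.2], by linarith [this.1]⟩

theorem hasDerivAt_cubicStep (k : ℕ) (hk : k + 1 < 3) (x : ℝ) :
    HasDerivAt (cubicStep k) (cubicStep (k + 1) x) x := by
  have hk' : k < 2 := by omega
  interval_cases k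
  · refine (((hasDerivAt_cubicSpline 1 x).const_mul (2 / 3)).const_sub 1).congr_deriv ?_
    simp only [cubicStep]
    push_cast
    ring
  · refine ((hasDerivAt_cubicSpline 0 x).const_mul (-2)).congr_deriv ?_
    simp only [cubicStep]
    push_cast
    ring

theorem abs_cubicStep_two_le (x : ℝ) : |cubicStep 2 x| ≤ 2 := by
  have := abs_cubicSpline_one_le x
  simp only [cubicStep, abs_mul]
  norm_num
  linarith

/-- With |F''| ≤ 2 one gets F'^2 ≤ 2 and c = 4. All four of `bound₁` to `bound₄` are then equalities
with M² = 16. -/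
theorem smoothStep_cubicStep :
    SmoothStep 3 4 cubicStep (fun k => if k = 1 then 2 else if k = 2 then 4 else 16) 4 2 2 := by
  have key := sq_deriv_le_of_mem_Icc two_pos (hasDerivAt_cubicStep 0 (by norm_num))
    (hasDerivAt_cubicStep 1 (by norm_num)) cubicStep_mem_Icc abs_cubicStep_two_le
  refine
    { two_le := by norm_num
      hasDerivAt := hasDerivAt_cubicStep
      right := fun x => by simpa using exists_deriv_cubicStep_right x
      left := fun x => by simpa using exists_deriv_cubicStep_left x
      mem_Icc := cubicStep_mem_Icc
      eq_one := fun x hx => ?_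
      eq_zero := fun x hx => ?_
      sq_deriv_le := fun x => (key x).1.trans (by norm_num)
      sq_le := fun k hk hk' x => ?_
      M_nonneg := by norm_num
      c_nonneg := by norm_num
      one_le_θ := by norm_num
      κ_nonneg := by norm_num
      a_le := fun k hk hk' => ?_
      a_succ_le := fun k hk hk' => ?_
      bound₁ := by norm_num
      bound₂ := by norm_num
      bound₃ := by norm_num
      bound₄ := by norm_num
      a_pos := by norm_num }
  · have h : cubicSpline 3 x = 0 := by
      rcases cubicSpline_cases 2 x with ⟨h, e⟩ | ⟨h, h', e⟩ | ⟨h, h', e⟩ | ⟨h, h', e⟩ | ⟨h, e⟩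
      · exact e
      · obtain rfl : x = -1 := le_antisymm hx h
        simpa using e
      all_goals exfalso; linarith
    simp [cubicStep, h]
  · have h : cubicSpline 3 x = 3 / 2 := by
      rcases cubicSpline_cases 2 x with ⟨h, e⟩ | ⟨h, h', e⟩ | ⟨h, h', e⟩ | ⟨h, h', e⟩ | ⟨h, e⟩
      · exfalso; linarith
      · exfalso; linarith
      · exfalso; linarith
      · obtain rfl : x = 1 := le_antisymm h' hx
        rw [e]
        norm_num
      · rw [e]
        ring
    simp only [cubicStep, h]
    norm_num
  · interval_cases k
    · simpa using (key x).2
    · have := sq_le_sq' (abs_le.1 (abs_cubicStep_two_le x)).1 (abs_le.1 (abs_cubicStep_two_le x)).2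
      simp only [OfNat.ofNat_ne_one, if_false, if_true]
      linarith
  · obtain rfl : k = 1 := by omega
    norm_num
  · obtain rfl : k = 1 := by omega
    norm_num

theorem quarticStep_mem_Icc (x : ℝ) : quarticStep 0 x ∈ Set.Icc (0 : ℝ) 1 := by
  have := quarticSpline_four_mem_Icc x
  simp only [quarticStep]
  exact ⟨by linarith [this.2], by linarith [this.1]⟩

theorem hasDerivAt_quarticStep (k : ℕ) (hk : k + 1 < 4) (x : ℝ) :
    HasDerivAt (quarticStep k) (quarticStep (k + 1) x) x := by
  have hk' : k < 3 := by omega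
  interval_cases k
  · refine ((hasDerivAt_quarticSpline 2 x).const_sub 1).congr_deriv ?_
    simp only [quarticStep]
    push_cast
    ring
  · refine ((hasDerivAt_quarticSpline 1 x).const_mul (-4)).congr_deriv ?_
    simp only [quarticStep]
    push_cast
    ring
  · refine ((hasDerivAt_quarticSpline 0 x).const_mul (-12)).congr_deriv ?_
    simp only [quarticStep]
    push_cast
    ring

theorem abs_quarticStep_two_le (x : ℝ) : |quarticStep 2 x| ≤ 5 / 2 := by
  have := abs_quarticSpline_two_le x
  simp only [quarticStep, abs_mul]
  norm_num
  linarith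

theorem abs_quarticStep_three_le (x : ℝ) : |quarticStep 3 x| ≤ 10 := by
  have := abs_quarticSpline_one_le x
  simp only [quarticStep, abs_mul]
  norm_num
  linarith

/-- The inputs |F''| ≤ 5/2, |F'''| ≤ 10 and |F''''| ≤ 24 are rounded up to the listed squares; c = 5
is twice 5/2. The four bounds read 486, 135, 500 and 576, against M² = 576. -/
theorem smoothStep_quarticStep :
    SmoothStep 4 24 quarticStep
      (fun k => if k = 1 then 3 else if k = 2 then 9 else if k = 3 then 100 else 576) 5 3 6 := by
  have key := sq_deriv_le_of_mem_Icc (by norm_num) (hasDerivAt_quarticStep 0 (by norm_num))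
    (hasDerivAt_quarticStep 1 (by norm_num)) quarticStep_mem_Icc abs_quarticStep_two_le
  refine
    { two_le := by norm_num
      hasDerivAt := hasDerivAt_quarticStep
      right := fun x => by simpa using exists_deriv_quarticStep_right x
      left := fun x => by simpa using exists_deriv_quarticStep_left x
      mem_Icc := quarticStep_mem_Icc
      eq_one := fun x hx => ?_
      eq_zero := fun x hx => ?_
      sq_deriv_le := fun x => (key x).1.trans (by norm_num)
      sq_le := fun k hk hk' x => ?_
      M_nonneg := by norm_num
      c_nonneg := by norm_num
      one_le_θ := by norm_num
      κ_nonneg := by norm_num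
      a_le := fun k hk hk' => ?_
      a_succ_le := fun k hk hk' => ?_
      bound₁ := by norm_num
      bound₂ := by norm_num
      bound₃ := by norm_num
      bound₄ := by norm_num
      a_pos := by norm_num }
  · obtain ⟨ha1, ha2⟩ := sqrt_two_div_two_mem_Icc
    have h : quarticSpline 4 x = 0 := by
      rcases quarticSpline_cases 3 x rfl with ⟨h, e⟩ | ⟨h, h', e⟩ | ⟨h, h', e⟩ | ⟨h, h', e⟩ |
        ⟨h, h', e⟩ | ⟨h, e⟩
      · exact e
      · obtain rfl : x = -1 := le_antisymm hx h
        simpa using e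
      all_goals exfalso; linarith
    simp [quarticStep, h]
  · obtain ⟨ha1, ha2⟩ := sqrt_two_div_two_mem_Icc
    have ha := sq_sqrt_two_div_two
    generalize hadef : √2 / 2 = a at ha ha1 ha2
    have h : quarticSpline 4 x = 1 := by
      rcases quarticSpline_cases 3 x hadef.symm with ⟨h, e⟩ | ⟨h, h', e⟩ | ⟨h, h', e⟩ |
        ⟨h, h', e⟩ | ⟨h, h', e⟩ | ⟨h, e⟩
      · exfalso; linarith
      · exfalso; linarith
      · exfalso; linarith
      · exfalso; linarith
      · obtain rfl : x = 1 := le_antisymm h' hx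
        rw [e]
        linear_combination (-24 - 4 * (a ^ 2 + 1 / 2)) * ha
      · rw [e]
        linear_combination (-24 * x ^ 2 - 4 * (a ^ 2 + 1 / 2)) * ha
    simp only [quarticStep, h]
    norm_num
  · interval_cases k
    · have := (key x).2
      simp only [if_true]
      linarith
    · have := sq_le_sq' (abs_le.1 (abs_quarticStep_two_le x)).1
        (abs_le.1 (abs_quarticStep_two_le x)).2
      norm_num
      linarith
    · have := sq_le_sq' (abs_le.1 (abs_quarticStep_three_le x)).1
        (abs_le.1 (abs_quarticStep_three_le x)).2
      norm_num
      linarith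
  · have : k < 3 := by omega
    interval_cases k <;> norm_num
  · have : k < 3 := by omega
    interval_cases k <;> norm_num

/-! ### The smoothing inequality and the choice of scale. -/

theorem constM_three : constM 3 = 4 := by
  have : (2 : ℝ) ^ ((3 : ℕ) - 2 : ℝ) = 2 := by
    rw [show ((3 : ℕ) - 2 : ℝ) = 1 by norm_num, Real.rpow_one]
  rw [constM, if_pos (by norm_num), this]
  norm_num [Nat.factorial]

theorem constM_four : constM 4 = 24 := by
  have : (2 : ℝ) ^ ((4 : ℕ) - 2 : ℝ) = 4 := by
    rw [show ((4 : ℕ) - 2 : ℝ) = (2 : ℕ) by norm_num, Real.rpow_natCast]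
    norm_num
  rw [constM, if_pos (by norm_num), this]
  norm_num [Nat.factorial]

theorem half_le_constM {m : ℕ} (hm : 1 ≤ m) : 1 / 2 ≤ constM m := by
  have h1 : (1 : ℝ) ≤ (m : ℝ) := by exact_mod_cast hm
  have hf : (1 : ℝ) ≤ ((m - 1).factorial : ℝ) := by exact_mod_cast Nat.one_le_iff_ne_zero.2 (Nat.factorial_ne_zero _)
  have h2 : (1 / 2 : ℝ) = 2 ^ (-1 : ℝ) := by
    rw [Real.rpow_neg_one]; norm_num
  have key : ∀ e : ℝ, -1 ≤ e → 1 / 2 ≤ (2 : ℝ) ^ e * ((m - 1).factorial : ℝ) := fun e he => by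
    have h3 : (1 / 2 : ℝ) ≤ 2 ^ e := by
      rw [h2]
      exact Real.rpow_le_rpow_of_exponent_le one_le_two he
    nlinarith
  rw [constM]
  split_ifs with h
  · exact key _ (by linarith)
  · exact key _ (by linarith)

theorem smoothDist_nonneg {d : ℕ} (m : ℕ) (μ ν : Measure (EuclideanSpace ℝ (Fin d))) :
    0 ≤ smoothDist m μ ν :=
  Real.iSup_nonneg fun _ => abs_nonneg _

/-- Smoothing inequality: if the orthant probabilities of `ν` are Lipschitz in the diagonal
direction with constant `C`, then `kolmogorovDist` is controlled by `smoothDist` at every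
scale `α`. -/
theorem kolmogorovDist_le_smoothDist {d m : ℕ} [Nonempty (Fin d)] (hm : 1 ≤ m)
    (μ ν : Measure (EuclideanSpace ℝ (Fin d))) [IsProbabilityMeasure μ] [IsProbabilityMeasure ν]
    {C : ℝ} (hν : OrthantLip ν C) {α : ℝ} (hα : 0 < α) :
    kolmogorovDist μ ν
      ≤ constM m * max 1 ((2 / α) ^ m) * smoothDist m μ ν + C * α := by
  have hK : 1 / 2 ≤ constM m * max 1 ((2 / α) ^ m) := by
    have := half_le_constM hm
    nlinarith [le_max_left 1 ((2 / α) ^ m)]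
  have key : ∀ z, HasUpperApprox m (constM m * max 1 ((2 / α) ^ m)) ν z (C * α) ∧
      HasLowerApprox m (constM m * max 1 ((2 / α) ^ m)) ν z (C * α) := fun z => by
    by_cases h3 : m = 3
    · subst h3
      rw [constM_three]
      exact ⟨smoothStep_cubicStep.hasUpperApprox hα hν z,
        smoothStep_cubicStep.hasLowerApprox hα hν z⟩
    by_cases h4 : m = 4
    · subst h4
      rw [constM_four]
      exact ⟨smoothStep_quarticStep.hasUpperApprox hα hν z,
        smoothStep_quarticStep.hasLowerApprox hα hν z⟩
    have hM := pow_self_le_four_mul_constM hm h3 h4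
    exact ⟨hasUpperApprox_of_pow_le hm hM hα hν z, hasLowerApprox_of_pow_le hm hM hα hν z⟩
  exact kolmogorovDist_le_of_approx hK μ ν (fun z => (key z).1) fun z => (key z).2

/-- Optimisation of `α ↦ M * max 1 ((2 / α) ^ m) * D + C * α`. -/
theorem le_of_forall_scale {m : ℕ} {κ M D C : ℝ} (hM : 0 < M) (hD : 0 ≤ D) (hC : 0 < C)
    (h : ∀ α : ℝ, 0 < α → κ ≤ M * max 1 ((2 / α) ^ m) * D + C * α) :
    κ ≤ 2 * C ^ ((m : ℝ) / ((m : ℝ) + 1)) * (2 ^ m * M * D) ^ (1 / ((m : ℝ) + 1)) + M * D ∧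
    (2 ^ m * M * D ≤ 2 ^ (m + 1) * C →
      κ ≤ 2 * C ^ ((m : ℝ) / ((m : ℝ) + 1)) * (2 ^ m * M * D) ^ (1 / ((m : ℝ) + 1))) := by
  have hm1 : (0 : ℝ) < (m : ℝ) + 1 := by positivity
  rcases hD.eq_or_lt with rfl | hD
  -- When D = 0 no scale is optimal; α tends to 0 instead.
  · have hκ : κ ≤ 0 := by
      refine le_of_forall_pos_le_add fun ε hε => ?_
      have := h (ε / C) (by positivity)
      rw [mul_zero, mul_div_cancel₀ _ hC.ne'] at this
      exact this
    rw [mul_zero, mul_zero, Real.zero_rpow (by positivity), mul_zero]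
    exact ⟨by simpa using hκ, fun _ => hκ⟩
  set N := 2 ^ m * M * D with hN
  have hN0 : 0 < N := by positivity
  -- This scale makes M(2/α)^m D equal to Cα.
  set α := (N / C) ^ (1 / ((m : ℝ) + 1)) with hα
  have hα0 : 0 < α := by positivity
  have hpow : α ^ (m + 1) = N / C := by
    rw [hα, ← Real.rpow_natCast, ← Real.rpow_mul (by positivity)]
    push_cast
    rw [one_div_mul_cancel hm1.ne', Real.rpow_one]
  have hCα : C * α = C ^ ((m : ℝ) / ((m : ℝ) + 1)) * N ^ (1 / ((m : ℝ) + 1)) := by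
    have e : (m : ℝ) / ((m : ℝ) + 1) = 1 - 1 / ((m : ℝ) + 1) := by field_simp; ring
    rw [hα, Real.div_rpow hN0.le hC.le, e, Real.rpow_sub hC, Real.rpow_one]
    ring
  have hMα : M * (2 / α) ^ m * D = C * α := by
    have e : C * α ^ (m + 1) = N := by rw [hpow]; field_simp
    rw [div_pow]
    field_simp
    rw [hN, pow_succ] at e
    linarith
  have h2 := h α hα0
  constructor
  · have h1 : max 1 ((2 / α) ^ m) ≤ 1 + (2 / α) ^ m := max_le (by simp; positivity) (by simp)
    have h3 : M * max 1 ((2 / α) ^ m) * D ≤ M * (1 + (2 / α) ^ m) * D := by gcongr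
    have h4 : M * (1 + (2 / α) ^ m) * D = M * D + C * α := by rw [← hMα]; ring
    rw [mul_assoc, ← hCα]
    linarith
  · intro hle
    have hα2 : α ≤ 2 := by
      refine le_of_pow_le_pow_left₀ (Nat.succ_ne_zero m) zero_le_two ?_
      rw [hpow, div_le_iff₀ hC]
      exact hle
    rw [max_eq_right (one_le_pow₀ ((one_le_div hα0).2 hα2)), hMα] at h2
    rw [mul_assoc, ← hCα]
    linarith

theorem proposition2p4 {Ω Ω' : Type*} [MeasurableSpace Ω] [MeasurableSpace Ω']
    (P : Measure Ω) [IsProbabilityMeasure P] (P' : Measure Ω') [IsProbabilityMeasure P']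
    (d m : ℕ) (hm : 1 ≤ m)
    (X : Ω → EuclideanSpace ℝ (Fin d)) (hX : AEMeasurable X P)
    (Y : Ω' → EuclideanSpace ℝ (Fin d))
    (μ : EuclideanSpace ℝ (Fin d)) (S : Matrix (Fin d) (Fin d) ℝ) (hS : S.PosSemidef)
    (hY : HasLaw Y (multivariateGaussian μ S) P')
    (hdiag : ∀ j, 0 < S j j)
    (σ : ℝ) (hσ : IsLeast (Set.range fun j : Fin d => Real.sqrt (S j j)) σ) :
    kolmogorovDist (P.map X) (P'.map Y)
        ≤ 2 * ((Real.sqrt (2 * Real.log d) + 2) / σ) ^ ((m : ℝ) / ((m : ℝ) + 1))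
            * (constN m * smoothDist m (P.map X) (P'.map Y)) ^ (1 / ((m : ℝ) + 1))
          + constM m * smoothDist m (P.map X) (P'.map Y)
    ∧ ((smoothDist m (P.map X) (P'.map Y) ≤ (2 + Real.sqrt (2 * Real.log d)) / (σ * constN m)
          ∨ (2 ≤ m ∧ smoothDist m (P.map X) (P'.map Y)
              ≤ (4 + 2 * Real.sqrt (2 * Real.log d)) / (σ * constM m))) →
        kolmogorovDist (P.map X) (P'.map Y)
          ≤ 2 * ((Real.sqrt (2 * Real.log d) + 2) / σ) ^ ((m : ℝ) / ((m : ℝ) + 1))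
              * (constN m * smoothDist m (P.map X) (P'.map Y)) ^ (1 / ((m : ℝ) + 1))) := by
  obtain ⟨⟨j₀, hj₀⟩, hmin⟩ := hσ
  have hσ0 : 0 < σ := hj₀ ▸ Real.sqrt_pos.2 (hdiag j₀)
  have hσle : ∀ j, σ ≤ Real.sqrt (S j j) := fun j => hmin ⟨j, rfl⟩
  have : Nonempty (Fin d) := ⟨j₀⟩
  have : IsProbabilityMeasure (P.map X) := Measure.isProbabilityMeasure_map hX
  have hM : 0 < constM m := one_half_pos.trans_le (half_le_constM hm)
  have hLip := orthantLip_multivariateGaussian μ hS (Fin.pos j₀) hσ0 hσle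
  rw [hY.map_eq]
  set C := (Real.sqrt (2 * Real.log d) + 2) / σ with hC
  have hC0 : 0 < C := by positivity
  have hD := smoothDist_nonneg m (P.map X) (multivariateGaussian μ S)
  obtain ⟨h1, h2⟩ := le_of_forall_scale (m := m) hM hD hC0
    fun α hα => kolmogorovDist_le_smoothDist hm (P.map X) _ hLip hα
  refine ⟨h1, fun h => h2 ?_⟩
  -- Both smallness conditions yield M'_m d_m ≤ 2C, which says that the optimal scale is at most 2.
  -- The second is exactly this inequality; the first gives 2^m M'_m d_m ≤ C.
  rw [pow_succ, mul_assoc, mul_assoc]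
  refine mul_le_mul_of_nonneg_left ?_ (by positivity)
  rcases h with h | ⟨-, h⟩
  · have hN : (2 + Real.sqrt (2 * Real.log d)) / (σ * constN m) = C / (2 ^ m * constM m) := by
      rw [hC, constN, div_div, add_comm]
    rw [hN, le_div_iff₀ (by positivity)] at h
    have : (1 : ℝ) ≤ 2 ^ m := one_le_pow₀ one_le_two
    nlinarith [mul_nonneg hM.le hD]
  · have hN : (4 + 2 * Real.sqrt (2 * Real.log d)) / (σ * constM m) = 2 * C / constM m := by
      rw [hC]
      field_simp
      ring
    rw [hN, le_div_iff₀ hM] at h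
    linarith
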